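/- **Model.** Let $T\ge 0$. A state-space model consists of latent states $X_0,\dots,X_T$, where $X_t$ takes values in a measurable space $E_t$, and of observations $Y_t=(Y_{t,1},\dots,Y_{t,m_t})\in\mathbb R^{m_t}$, $0\le t\le T$. $X_0$ has law $\mu_0$; the only parent of $X_{t+1}$ is $X_t$, with transition kernel $\kappa_t(x,\cdot)$; the only parent of each $Y_{t,i}$ is $X_t$. That is, conditionally on all its non-descendants each variable has the law given by its kernel at its parent. The law of $Y_{t,i}$ given $X_t=x$ is a mixture $$P(Y_{t,i}\in C\mid X_t=x)=\sum_{y\in C}F_{t,i}(y\mid x)+\int_C f_{t,i}(y\mid x)\,dy ,$$ with point masses $F_{t,i}\ge0$ and a jointly measurable density $f_{t,i}\ge0$. Assume, for all $t\le T$ and all $i$: 1. there is a countable set $A_{t,i}\subset\mathbb R$ such that, almost surely, $F_{t,i}(y\mid X_t)=0$ for all $y\notin A_{t,i}$; 2. for Lebesgue-almost every $y$, $E[f_{t,i}(y\mid X_t)^p]<\infty$ for all $p\in\mathbb N$ (for instance, $f_{t,i}(y\mid\cdot)$ is bounded); 3. the test function $f_t:E_t\to\mathbb R$ is measurable and $E|f_t(X_t)|^p<\infty$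 for all $p\in\mathbb N$ (for instance, $f_t$ is bounded). **Algorithm.** The lexicographic particle filter with $K$ particles, run on data $y_0,\dots,y_T$, draws $x_0^{(1)},\dots,x_0^{(K)}$ independently from $\mu_0$. At each time $t$ it computes for each particle a pair $(d^{(k)},w^{(k)})$, starting from $(0,1)$ and updating, for $i=1,\dots,m_t$ in turn, by $$(d,w)\leftarrow\begin{cases}(d,\;w\,F_{t,i}(y_{t,i}\mid x_t^{(k)}))&\text{if }F_{t,i}(y_{t,i}\mid x_t^{(k)})>0,\\(d+1,\;w\,f_{t,i}(y_{t,i}\mid x_t^{(k)}))&\text{otherwise.}\end{cases}$$ It puts $d^\star=\min_{k:\,w^{(k)}\ne0}d^{(k)}$, sets $w^{(k)}\leftarrow0$ for all $k$ with $d^{(k)}>d^\star$, and outputs $$\hat f_t^{K}=\frac{\sum_k w^{(k)}f_t(x_t^{(k)})}{\sum_k w^{(k)}}.$$ If $t<T$, it then resamples: given the past, indices $a_t^{(1)},\dots,a_t^{(K)}$ are drawn independently with $P(a_t^{(k)}=j)=w^{(j)}/\sum_l w^{(l)}$ (arbitrarily if all weights vanish), and then $x_{t+1}^{(k)}$, $k=1,\dots,K$,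 are drawn independently from $\kappa_t(x_t^{(a_t^{(k)})},\cdot)$. **Theorem.** The lexicographic particle filter is consistent. For almost every realization $(y_t)_{t\le T}$ of the observations, if for every $K$ the filter with $K$ particles is run on $(y_t)_{t\le T}$, all runs being defined on one probability space with an arbitrary dependence between the runs for different $K$, then almost surely, for all $0\le t\le T$, $$\hat f_t^{K}\longrightarrow E[f_t(X_t)\mid Y_{0:t}=y_{0:t}]\qquad\text{as }K\to\infty .$$ -/

import Mathlib

open MeasureTheory ProbabilityTheory Filter Topology
open scoped NNReal ENNReal

noncomputable section

namespace LPF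

/-- A state-space model with mixed discrete/continuous observations. At time `t` the latent state
lives in the measurable space `E t`, and `m t` real variables `Y_{t,0}, …, Y_{t, m t - 1}` are
observed. The parent of `X_{t+1}` is `X_t` and the parent of every `Y_{t,i}` is `X_t`.
The law of `Y_{t,i}` given `X_t = x` is the mixture of a discrete distribution with point masses
`mass t i x y` and a part with Lebesgue density `dens t i x y`. -/
structure MixedSSM (E : ℕ → Type*) [∀ t, MeasurableSpace (E t)] (m : ℕ → ℕ) where
  /-- law of `X_0` -/
  init : Measure (E 0)
  /-- law of `X_{t+1}` given `X_t` -/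
  trans : ∀ t, Kernel (E t) (E (t + 1))
  /-- law of `Y_{t,i}` given `X_t` -/
  obs : ∀ t, Fin (m t) → Kernel (E t) ℝ
  /-- point masses `F_{t,i}(y | x)` -/
  mass : ∀ t, Fin (m t) → E t → ℝ → ℝ≥0
  /-- densities `f_{t,i}(y | x)` -/
  dens : ∀ t, Fin (m t) → E t → ℝ → ℝ≥0
  isProb_init : IsProbabilityMeasure init
  isMarkov_trans : ∀ t, IsMarkovKernel (trans t)
  isMarkov_obs : ∀ t i, IsMarkovKernel (obs t i)
  measurable_dens : ∀ t i, Measurable (fun p : E t × ℝ => dens t i p.1 p.2)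
  obs_eq : ∀ t i x, obs t i x =
    Measure.sum (fun y : ℝ => (mass t i x y : ℝ≥0∞) • Measure.dirac y) +
      volume.withDensity (fun y => (dens t i x y : ℝ≥0∞))

/-- One update of the tuple (number of densities, weight) at an observed value whose point mass
is `F` and whose density is `f`. -/
def lexUpdate (p : ℕ × ℝ≥0) (F f : ℝ≥0) : ℕ × ℝ≥0 :=
  if 0 < F then (p.1, p.2 * F) else (p.1 + 1, p.2 * f)

/-- The `σ`-algebra generated by `Y_0, …, Y_t`. -/
abbrev obsSigma {Ω : Type*} {m : ℕ → ℕ} (Y : ∀ t, Ω → Fin (m t) → ℝ) (t : ℕ) : MeasurableSpace Ω :=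
  ⨆ s, ⨆ (_ : s ≤ t), MeasurableSpace.comap (Y s) inferInstance

namespace MixedSSM

variable {E : ℕ → Type*} [∀ t, MeasurableSpace (E t)] {m : ℕ → ℕ}

/-- The random variables `X_0, …, X_T, Y_0, …, Y_T` on `(Ω, P)` have the joint law of the model:
`X_0` has the initial law, and the conditional law of every other variable given all its
non-descendants (parents included) is its kernel evaluated at its parent.
The non-descendants of `X_{t+1}` are `X_s, Y_s` with `s ≤ t`; those of `Y_{t,i}` are all variables
other than `Y_{t,i}` itself. -/
structure Represents (M : MixedSSM E m) (T : ℕ) {Ω : Type*} [MeasurableSpace Ω] (P : Measure Ω)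
    (X : ∀ t, Ω → E t) (Y : ∀ t, Ω → Fin (m t) → ℝ) : Prop where
  measurable_X : ∀ t ≤ T, Measurable (X t)
  measurable_Y : ∀ t ≤ T, Measurable (Y t)
  init : P.map (X 0) = M.init
  trans : ∀ t < T, ∀ B : Set (E (t + 1)), MeasurableSet B →
    P[(X (t + 1) ⁻¹' B).indicator (fun _ => (1 : ℝ)) |
        ⨆ s, ⨆ (_ : s ≤ t), MeasurableSpace.comap (X s) inferInstance ⊔
          MeasurableSpace.comap (Y s) inferInstance]
      =ᵐ[P] fun ω => (M.trans t (X t ω)).real B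
  obs : ∀ t ≤ T, ∀ i : Fin (m t), ∀ C : Set ℝ, MeasurableSet C →
    P[((fun ω => Y t ω i) ⁻¹' C).indicator (fun _ => (1 : ℝ)) |
        (⨆ s, ⨆ (_ : s ≤ T), MeasurableSpace.comap (X s) inferInstance) ⊔
          ⨆ q : Σ s, Fin (m s), ⨆ (_ : q.1 ≤ T ∧ q ≠ ⟨t, i⟩),
            MeasurableSpace.comap (fun ω => Y q.1 ω q.2) inferInstance]
      =ᵐ[P] fun ω => (M.obs t i (X t ω)).real C

/-- The tuple `(d, w)` of a particle in state `x` at time `t` when `y` is observed: start from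
`(0, 1)` and update at each observed coordinate in turn. -/
def lexWeight (M : MixedSSM E m) (t : ℕ) (y : Fin (m t) → ℝ) (x : E t) : ℕ × ℝ≥0 :=
  (List.finRange (m t)).foldl (fun p i => lexUpdate p (M.mass t i x (y i)) (M.dens t i x (y i)))
    (0, 1)

/-- The minimal number of densities among the particles of nonzero weight (an irrelevant `0` if
all weights vanish). -/
def dStar (M : MixedSSM E m) (t : ℕ) (y : Fin (m t) → ℝ) {K : ℕ} (x : Fin K → E t) : ℕ :=
  sInf {d | ∃ k, (M.lexWeight t y (x k)).2 ≠ 0 ∧ (M.lexWeight t y (x k)).1 = d}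

/-- The weight of the `k`-th particle after the weights of all particles with non-minimal `d`
have been set to zero. -/
def keptWeight (M : MixedSSM E m) (t : ℕ) (y : Fin (m t) → ℝ) {K : ℕ} (x : Fin K → E t)
    (k : Fin K) : ℝ :=
  if M.dStar t y x < (M.lexWeight t y (x k)).1 then 0 else ((M.lexWeight t y (x k)).2 : ℝ)

/-- The output of the lexicographic particle filter at time `t` for the test function `f`, when the
particles at time `t` are `x` and `y` is observed. -/
def output (M : MixedSSM E m) (t : ℕ) (y : Fin (m t) → ℝ) (f : E t → ℝ) {K : ℕ}
    (x : Fin K → E t) : ℝ :=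
  (∑ k, M.keptWeight t y x k * f (x k)) / ∑ k, M.keptWeight t y x k

/-- `(ξ, α)` is a run, on the probability space `(Ω', ν)`, of the lexicographic particle filter with
`K` particles on the data `y_0, …, y_T`. Here `ξ t ω' k` is the `k`-th particle at time `t` and
`α t ω' k` is the index of the particle at time `t` that is selected for the `k`-th place in the
resampling step at time `t`.
* The initial particles are independent with law `M.init`.
* Given the past, the resampling indices are independent, and index `j` has probability
  proportional to the kept weight of particle `j`; nothing is prescribed where all the kept
  weights are zero.
* Given the past and the resampled particles, the particles at time `t + 1` are independent, and
  the `k`-th one is drawn from the transition kernel at the `k`-th resampled particle. -/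
structure IsRun (M : MixedSSM E m) (T : ℕ) (y : ∀ t, Fin (m t) → ℝ) (K : ℕ)
    {Ω' : Type*} [MeasurableSpace Ω'] (ν : Measure Ω')
    (ξ : ∀ t, Ω' → Fin K → E t) (α : ℕ → Ω' → Fin K → Fin K) : Prop where
  measurable_particle : ∀ t ≤ T, Measurable (ξ t)
  measurable_index : ∀ t < T, Measurable (α t)
  init : ν.map (ξ 0) = Measure.pi (fun _ => M.init)
  resample : ∀ t < T, ∀ j : Fin K → Fin K, ∀ᵐ ω' ∂ν,
    (∑ k, M.keptWeight t (y t) (ξ t ω') k) ≠ 0 →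
    (ν[(α t ⁻¹' {j}).indicator (fun _ => (1 : ℝ)) |
        (⨆ s, ⨆ (_ : s ≤ t), MeasurableSpace.comap (ξ s) inferInstance) ⊔
          ⨆ s, ⨆ (_ : s < t), MeasurableSpace.comap (α s) inferInstance]) ω'
      = ∏ k, (M.keptWeight t (y t) (ξ t ω') (j k) / (∑ l, M.keptWeight t (y t) (ξ t ω') l))
  propagate : ∀ t < T, ∀ B : Set (Fin K → E (t + 1)), MeasurableSet B →
    ν[(ξ (t + 1) ⁻¹' B).indicator (fun _ => (1 : ℝ)) |
        ⨆ s, ⨆ (_ : s ≤ t), MeasurableSpace.comap (ξ s) inferInstance ⊔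
          MeasurableSpace.comap (α s) inferInstance]
      =ᵐ[ν] fun ω' => (Measure.pi (fun k => M.trans t (ξ t ω' (α t ω' k)))).real B

end MixedSSM

end LPF

end

/-!
Conditionally on the past of a run, the particles at time `t + 1` are independent draws from a
mixture of transition laws, weighted by the kept weights. A fourth-moment bound for the deviation
of their empirical mean from its conditional mean is `O(K⁻²)`, so Borel–Cantelli gives almost sure
convergence whatever the dependence between the runs for different `K`. By induction on time, the
empirical means converge to the means of the predictive laws.

The lexicographic weights enter as follows. With respect to Lebesgue measure plus the counting
measure on a countable set `A` of possible atoms, an observation has a genuine density: the point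
mass on `A` and the Lebesgue density off `A`. The number of observed coordinates lying outside `A`
is the same for all particles, and it is the smallest count `d` that a particle of nonzero weight
can have. Hence, as soon as some particle has positive likelihood, the kept weights are exactly
the likelihoods, and the limit of the filter's output is the one given by Bayes' formula.
-/

noncomputable section

namespace LPF

section Moments

variable {Ω : Type*} [MeasurableSpace Ω] {μ : Measure Ω} [IsProbabilityMeasure μ]

lemma integrable_pow_of_memLp {X : Ω → ℝ} {n a : ℕ} (hX : MemLp X n μ) (ha : a ≤ n) :
    Integrable (fun ω => X ω ^ a) μ :=
  (hX.mono_exponent (by exact_mod_cast ha)).integrable_norm_pow'.mono (hX.1.pow a)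
    (ae_of_all _ fun ω => by simp)

lemma sq_integral_le_integral_sq {X : Ω → ℝ} (hX : MemLp X 2 μ) :
    (∫ ω, X ω ∂μ) ^ 2 ≤ ∫ ω, X ω ^ 2 ∂μ := by
  simpa only [variance_eq_sub hX, sub_nonneg] using! variance_nonneg X μ

lemma memLp_sq_of_memLp_four {X : Ω → ℝ} (hX : MemLp X (4 : ℕ) μ) :
    MemLp (fun ω => X ω ^ 2) 2 μ := by
  refine (memLp_two_iff_integrable_sq (hX.1.pow 2)).2 ?_
  simpa only [Pi.pow_apply, ← pow_mul] using integrable_pow_of_memLp hX le_rfl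

lemma sq_integral_sq_le_integral_pow_four {X : Ω → ℝ} (hX : MemLp X (4 : ℕ) μ) :
    (∫ ω, X ω ^ 2 ∂μ) ^ 2 ≤ ∫ ω, X ω ^ 4 ∂μ := by
  simpa only [← pow_mul] using sq_integral_le_integral_sq (memLp_sq_of_memLp_four hX)

lemma integral_pow_four_le {X : Ω → ℝ} (hX : MemLp X (4 : ℕ) μ) :
    (∫ ω, X ω ∂μ) ^ 4 ≤ ∫ ω, X ω ^ 4 ∂μ := by
  have hsq := sq_integral_le_integral_sq (hX.mono_exponent (p := 2) (by norm_num))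
  calc (∫ ω, X ω ∂μ) ^ 4 = ((∫ ω, X ω ∂μ) ^ 2) ^ 2 := by ring
    _ ≤ (∫ ω, X ω ^ 2 ∂μ) ^ 2 := by gcongr
    _ ≤ ∫ ω, X ω ^ 4 ∂μ := sq_integral_sq_le_integral_pow_four hX

lemma integral_sub_integral_pow_four_le {X : Ω → ℝ} (hX : MemLp X (4 : ℕ) μ) :
    ∫ ω, (X ω - ∫ ω', X ω' ∂μ) ^ 4 ∂μ ≤ 16 * ∫ ω, X ω ^ 4 ∂μ := by
  set c := ∫ ω, X ω ∂μ
  have hX4 : Integrable (fun ω => X ω ^ 4) μ := integrable_pow_of_memLp hX le_rfl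
  have hpow (x : ℝ) : (x - c) ^ 4 ≤ 8 * x ^ 4 + 8 * c ^ 4 := by
    nlinarith [sq_nonneg (x + c), sq_nonneg (x - c), sq_nonneg (x ^ 2 - c ^ 2),
      sq_nonneg ((x + c) ^ 2)]
  calc ∫ ω, (X ω - c) ^ 4 ∂μ ≤ ∫ ω, (8 * X ω ^ 4 + 8 * c ^ 4) ∂μ :=
        integral_mono (integrable_pow_of_memLp (hX.sub (memLp_const c)) le_rfl)
          ((hX4.const_mul 8).add (integrable_const _)) fun ω => hpow (X ω)
    _ = 8 * ∫ ω, X ω ^ 4 ∂μ + 8 * c ^ 4 := by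
        rw [integral_add (hX4.const_mul 8) (integrable_const _), integral_const_mul,
          integral_const, probReal_univ, one_smul]
    _ ≤ 16 * ∫ ω, X ω ^ 4 ∂μ := by linarith [integral_pow_four_le hX]

lemma integral_add_pow_four_of_indepFun {X Z : Ω → ℝ} (hX : MemLp X (4 : ℕ) μ)
    (hZ : MemLp Z (4 : ℕ) μ) (hXZ : IndepFun X Z μ) (hX0 : ∫ ω, X ω ∂μ = 0)
    (hZ0 : ∫ ω, Z ω ∂μ = 0) :
    ∫ ω, (X ω + Z ω) ^ 4 ∂μ
      = ∫ ω, X ω ^ 4 ∂μ + 6 * ((∫ ω, X ω ^ 2 ∂μ) * ∫ ω, Z ω ^ 2 ∂μ) + ∫ ω, Z ω ^ 4 ∂μ := by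
  have hind (j k : ℕ) : IndepFun (fun ω => X ω ^ j) (fun ω => Z ω ^ k) μ :=
    hXZ.comp (φ := fun x => x ^ j) (ψ := fun x => x ^ k) (by fun_prop) (by fun_prop)
  have hint {j k : ℕ} (hj : j ≤ 4) (hk : k ≤ 4) : Integrable (fun ω => X ω ^ j * Z ω ^ k) μ :=
    (hind j k).integrable_mul (integrable_pow_of_memLp hX hj) (integrable_pow_of_memLp hZ hk)
  have hmul (j k : ℕ) :
      ∫ ω, X ω ^ j * Z ω ^ k ∂μ = (∫ ω, X ω ^ j ∂μ) * ∫ ω, Z ω ^ k ∂μ :=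
    (hind j k).integral_fun_mul_eq_mul_integral (hX.1.pow j) (hZ.1.pow k)
  have hexpand (ω : Ω) : (X ω + Z ω) ^ 4 = ∑ j ∈ Finset.range 5,
      X ω ^ j * Z ω ^ (4 - j) * (Nat.choose 4 j : ℝ) := add_pow _ _ _
  simp_rw [hexpand]
  rw [integral_finsetSum _ fun j hj =>
    (hint (Nat.lt_succ_iff.1 (Finset.mem_range.1 hj)) (Nat.sub_le 4 j)).mul_const _]
  simp_rw [integral_mul_const, hmul]
  simp only [Finset.sum_range_succ, Finset.sum_range_zero, Nat.choose, hX0, hZ0, integral_const,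
    probReal_univ, smul_eq_mul, pow_zero, pow_one, tsub_zero, tsub_self, Nat.reduceSub,
    Nat.reduceAdd, Nat.add_one_sub_one, Nat.cast_one, Nat.cast_ofNat]
  ring

variable {ι : Type*} {Z : ι → Ω → ℝ}

lemma integral_sum_sq_of_iIndepFun (hmem : ∀ i, MemLp (Z i) 2 μ) (hind : iIndepFun Z μ)
    (h0 : ∀ i, ∫ ω, Z i ω ∂μ = 0) (s : Finset ι) :
    ∫ ω, (∑ i ∈ s, Z i ω) ^ 2 ∂μ = ∑ i ∈ s, ∫ ω, Z i ω ^ 2 ∂μ := by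
  have hvar := IndepFun.variance_sum (s := s) (fun i _ => hmem i)
    fun i _ j _ hij => hind.indepFun hij
  have hsum : ∫ ω, (∑ i ∈ s, Z i) ω ∂μ = 0 := by
    simp only [Finset.sum_apply]
    rw [integral_finsetSum _ fun i _ => (hmem i).integrable one_le_two]
    exact Finset.sum_eq_zero fun i _ => h0 i
  rw [variance_of_integral_eq_zero (memLp_finsetSum' s fun i _ => hmem i).aemeasurable hsum] at hvar
  simpa only [Finset.sum_apply, variance_of_integral_eq_zero (hmem _).aemeasurable (h0 _)]
    using hvar

lemma integral_sum_pow_four_le (hmeas : ∀ i, Measurable (Z i))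
    (hmem : ∀ i, MemLp (Z i) (4 : ℕ) μ) (hind : iIndepFun Z μ) (h0 : ∀ i, ∫ ω, Z i ω ∂μ = 0)
    {C : ℝ} (hC : ∀ i, ∫ ω, Z i ω ^ 4 ∂μ ≤ C) (s : Finset ι) :
    ∫ ω, (∑ i ∈ s, Z i ω) ^ 4 ∂μ ≤ 3 * s.card ^ 2 * C := by
  classical
  have hmem2 (i : ι) : MemLp (Z i) 2 μ := (hmem i).mono_exponent (by norm_num)
  have hsq (i : ι) := (sq_integral_sq_le_integral_pow_four (hmem i)).trans (hC i)
  induction s using Finset.induction_on with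
  | empty => simp
  | insert a s ha ih =>
    have hSZ : IndepFun (fun ω => ∑ i ∈ s, Z i ω) (Z a) μ := by
      simpa only [Finset.sum_fn] using hind.indepFun_finsetSum_of_notMem hmeas ha
    have hS0 : ∫ ω, ∑ i ∈ s, Z i ω ∂μ = 0 := by
      rw [integral_finsetSum _ fun i _ => (hmem2 i).integrable one_le_two]
      exact Finset.sum_eq_zero fun i _ => h0 i
    have hcross : (∫ ω, (∑ i ∈ s, Z i ω) ^ 2 ∂μ) * ∫ ω, Z a ω ^ 2 ∂μ ≤ s.card * C := by
      rw [integral_sum_sq_of_iIndepFun hmem2 hind h0, Finset.sum_mul, ← nsmul_eq_mul]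
      refine Finset.sum_le_card_nsmul s _ C fun i _ => ?_
      nlinarith [sq_nonneg (∫ ω, Z i ω ^ 2 ∂μ - ∫ ω, Z a ω ^ 2 ∂μ), hsq i, hsq a]
    have hC0 : 0 ≤ C := (sq_nonneg _).trans (hsq a)
    simp_rw [Finset.sum_insert ha, add_comm (Z a _)]
    rw [integral_add_pow_four_of_indepFun (memLp_finsetSum s fun i _ => hmem i) (hmem a) hSZ hS0
      (h0 a), Finset.card_insert_of_notMem ha]
    push_cast
    nlinarith [hC a]

end Moments

section EmpiricalMean

variable {E : Type*} [MeasurableSpace E] {μ : Measure E}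

lemma memLp_natCast_iff {φ : E → ℝ} (hφ : Measurable φ) {p : ℕ} (hp : p ≠ 0) :
    MemLp φ p μ ↔ ∫⁻ x, ‖φ x‖ₑ ^ p ∂μ < ∞ := by
  rw [MemLp, eLpNorm_lt_top_iff_lintegral_rpow_enorm_lt_top (by exact_mod_cast hp) (by simp)]
  simp only [ENNReal.toReal_natCast, ENNReal.rpow_natCast]
  exact and_iff_right hφ.aestronglyMeasurable

variable [IsProbabilityMeasure μ] {φ : E → ℝ}

lemma integral_empirical_error_pow_four_le (hφ : Measurable φ) (hmem : MemLp φ (4 : ℕ) μ) {K : ℕ}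
    (hK : 0 < K) :
    ∫ z : Fin K → E, ((∑ k, φ (z k)) / K - ∫ x, φ x ∂μ) ^ 4 ∂(Measure.pi fun _ => μ)
      ≤ 48 * (∫ x, φ x ^ 4 ∂μ) / K ^ 2 := by
  set c := ∫ x, φ x ∂μ
  have hφc : MemLp (fun x => φ x - c) (4 : ℕ) μ := hmem.sub (memLp_const c)
  have hind : iIndepFun (fun k (z : Fin K → E) => φ (z k) - c) (Measure.pi fun _ => μ) :=
    iIndepFun_pi (X := fun _ x => φ x - c) fun _ => (hφ.sub_const c).aemeasurable
  have hmean (k : Fin K) : ∫ z, (φ (z k) - c) ∂(Measure.pi fun _ : Fin K => μ) = 0 := by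
    rw [integral_comp_eval (μ := fun _ : Fin K => μ) (f := fun x => φ x - c) (by fun_prop),
      integral_sub (hmem.integrable (by norm_num)) (integrable_const c), integral_const,
      probReal_univ, one_smul, sub_self]
  have hfour (k : Fin K) : ∫ z, (φ (z k) - c) ^ 4 ∂(Measure.pi fun _ : Fin K => μ)
      ≤ 16 * ∫ x, φ x ^ 4 ∂μ := by
    rw [integral_comp_eval (μ := fun _ : Fin K => μ) (f := fun x => (φ x - c) ^ 4) (by fun_prop)]
    exact integral_sub_integral_pow_four_le hmem
  have hsum := integral_sum_pow_four_le (Z := fun k (z : Fin K → E) => φ (z k) - c)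
    (fun k => by fun_prop)
    (fun k => hφc.comp_measurePreserving (measurePreserving_eval (fun _ : Fin K => μ) k))
    hind hmean hfour Finset.univ
  have herror (z : Fin K → E) :
      ((∑ k, φ (z k)) / K - c) ^ 4 = (∑ k, (φ (z k) - c)) ^ 4 / (K : ℝ) ^ 4 := by
    rw [← div_pow]
    congr 1
    simp only [Finset.sum_sub_distrib, Finset.sum_const, Finset.card_univ, Fintype.card_fin,
      nsmul_eq_mul]
    field_simp
  rw [Finset.card_univ, Fintype.card_fin] at hsum
  simp_rw [herror]
  rw [integral_div, div_le_div_iff₀ (by positivity) (by positivity)]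
  calc _ ≤ 3 * (K : ℝ) ^ 2 * (16 * ∫ x, φ x ^ 4 ∂μ) * K ^ 2 := by gcongr
    _ = _ := by ring

lemma measure_empirical_error_ge_le (hφ : Measurable φ) {R : ℝ≥0}
    (hR : ∫⁻ x, ‖φ x‖ₑ ^ 4 ∂μ ≤ R) {ε : ℝ} (hε : 0 < ε) {K : ℕ} (hK : 0 < K) :
    (Measure.pi fun _ => μ) {z : Fin K → E | ε ≤ |(∑ k, φ (z k)) / K - ∫ x, φ x ∂μ|}
      ≤ ENNReal.ofReal (48 * R / ε ^ 4 / K ^ 2) := by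
  have hmem : MemLp φ (4 : ℕ) μ :=
    (memLp_natCast_iff hφ four_ne_zero).2 (hR.trans_lt ENNReal.coe_lt_top)
  have hφ4 : ∫ x, φ x ^ 4 ∂μ ≤ R := by
    have hpow (x : E) : ‖φ x ^ 4‖ₑ = ‖φ x‖ₑ ^ 4 := enorm_pow _ _
    have := enorm_integral_le_lintegral_enorm (μ := μ) fun x => φ x ^ 4
    simp_rw [hpow] at this
    exact (le_abs_self _).trans (by simpa using! this.trans hR)
  set D : (Fin K → E) → ℝ := fun z => (∑ k, φ (z k)) / K - ∫ x, φ x ∂μ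
  have hD : Integrable (fun z => D z ^ 4) (Measure.pi fun _ : Fin K => μ) := by
    refine integrable_pow_of_memLp (n := 4) (MemLp.sub ?_ (memLp_const _)) le_rfl
    simp_rw [div_eq_mul_inv]
    exact (memLp_finsetSum _ fun k _ =>
      hmem.comp_measurePreserving (measurePreserving_eval (fun _ : Fin K => μ) k)).mul_const _
  have hmarkov := mul_meas_ge_le_integral_of_nonneg (ae_of_all _ fun z => by positivity) hD (ε ^ 4)
  have hevent : {z | ε ≤ |D z|} = {z | ε ^ 4 ≤ D z ^ 4} := by
    ext z
    rw [Set.mem_ofPred_eq, Set.mem_ofPred_eq, ← Even.pow_abs (by decide) (D z),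
      pow_le_pow_iff_left₀ hε.le (abs_nonneg _) four_ne_zero]
  rw [hevent, ← ofReal_measureReal]
  refine ENNReal.ofReal_le_ofReal ?_
  rw [div_right_comm, le_div_iff₀' (by positivity)]
  exact hmarkov.trans ((integral_empirical_error_pow_four_le hφ hmem hK).trans (by gcongr))

end EmpiricalMean

section BorelCantelli

variable {Ω : Type*} [MeasurableSpace Ω] {ν : Measure Ω}

lemma ae_eventually_notMem_of_measure_le_div_sq {A : ℕ → Set Ω} {C : ℝ}
    (hA : ∀ K : ℕ, 0 < K → ν (A K) ≤ ENNReal.ofReal (C / K ^ 2)) :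
    ∀ᵐ ω ∂ν, ∀ᶠ K in atTop, ω ∉ A K := by
  have hsum : ∑' K, ν (A (K + 1)) ≠ ∞ := by
    refine ne_top_of_le_ne_top ?_ (ENNReal.tsum_le_tsum fun K => hA (K + 1) K.succ_pos)
    have hsummable : Summable fun K : ℕ => C / (K : ℝ) ^ 2 := by
      simpa only [mul_one_div] using (Real.summable_one_div_nat_pow.2 one_lt_two).mul_left C
    exact ((summable_nat_add_iff 1).2 hsummable).tsum_ofReal_ne_top
  filter_upwards [ae_eventually_notMem hsum] with ω hω
  rw [← map_add_atTop_eq_nat 1]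
  exact eventually_map.2 hω

lemma ae_tendsto_zero_of_measure_le_div_sq {D : ℕ → Ω → ℝ} {G : ℕ → ℕ → Set Ω}
    (hD : ∀ (R : ℕ) (ε : ℝ), 0 < ε → ∃ C : ℝ, ∀ K : ℕ, 0 < K →
      ν {ω ∈ G R K | ε ≤ |D K ω|} ≤ ENNReal.ofReal (C / K ^ 2))
    (hG : ∀ᵐ ω ∂ν, ∃ R, ∀ᶠ K in atTop, ω ∈ G R K) :
    ∀ᵐ ω ∂ν, Tendsto (fun K => D K ω) atTop (𝓝 0) := by
  have hev (R n : ℕ) :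
      ∀ᵐ ω ∂ν, ∀ᶠ K in atTop, ω ∉ {ω ∈ G R K | 1 / ((n : ℝ) + 1) ≤ |D K ω|} := by
    obtain ⟨C, hC⟩ := hD R _ (Nat.one_div_pos_of_nat (n := n))
    exact ae_eventually_notMem_of_measure_le_div_sq hC
  filter_upwards [ae_all_iff.2 fun R => ae_all_iff.2 (hev R), hG] with ω hω ⟨R, hR⟩
  rw [Metric.tendsto_nhds]
  intro δ hδ
  obtain ⟨n, hn⟩ := exists_nat_one_div_lt hδ
  filter_upwards [hω R n, hR] with K hK hRK
  rw [Real.dist_0_eq_abs]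
  exact (not_le.1 fun h => hK ⟨hRK, h⟩).trans hn

end BorelCantelli

section Pi

variable {ι : Type*} [Fintype ι] {F : ι → Type*}

lemma indicator_univ_pi_prod (B : ∀ i, Set (F i)) (f : ∀ i, F i → ℝ≥0∞) (y : ∀ i, F i) :
    (Set.univ.pi B).indicator (fun y => ∏ i, f i (y i)) y = ∏ i, (B i).indicator (f i) (y i) := by
  by_cases hy : y ∈ Set.univ.pi B
  · rw [Set.indicator_of_mem hy]
    exact Finset.prod_congr rfl fun i _ => (Set.indicator_of_mem (hy i trivial) _).symm
  · obtain ⟨i, -, hi⟩ : ∃ i ∈ Set.univ, y i ∉ B i := by simpa only [Set.mem_pi, not_forall,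
      exists_prop] using hy
    rw [Set.indicator_of_notMem hy,
      Finset.prod_eq_zero (Finset.mem_univ i) (Set.indicator_of_notMem hi _)]

variable [∀ i, MeasurableSpace (F i)]

lemma lintegral_pi_prod (μ : ∀ i, Measure (F i)) [∀ i, SigmaFinite (μ i)] {f : ∀ i, F i → ℝ≥0∞}
    (hf : ∀ i, Measurable (f i)) :
    ∫⁻ y, ∏ i, f i (y i) ∂Measure.pi μ = ∏ i, ∫⁻ v, f i v ∂μ i := by
  classical
  have hprod (s : Finset ι) : Measurable fun y : ∀ i, F i => ∏ i ∈ s, f i (y i) :=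
    Finset.measurable_fun_prod _ fun i _ => (hf i).comp (measurable_pi_apply i)
  have hmarginal (s : Finset ι) (y : ∀ i, F i) :
      lmarginal μ s (fun z => ∏ i ∈ s, f i (z i)) y = ∏ i ∈ s, ∫⁻ v, f i v ∂μ i := by
    induction s using Finset.induction_on generalizing y with
    | empty => simp
    | insert i s hi ih =>
      have hinner (z : ∀ i, F i) :
          ∫⁻ v, ∏ j ∈ insert i s, f j (Function.update z i v j) ∂μ i
            = (∫⁻ v, f i v ∂μ i) * ∏ j ∈ s, f j (z j) := by
        rw [← lintegral_mul_const _ (hf i)]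
        refine lintegral_congr fun v => ?_
        rw [Finset.prod_insert hi, Function.update_self]
        congr 1
        exact Finset.prod_congr rfl fun j hj => by
          rw [Function.update_of_ne (ne_of_mem_of_not_mem hj hi)]
      rw [lmarginal_insert' _ (hprod _) hi, Finset.prod_insert hi, ← ih y]
      simp_rw [hinner]
      exact lintegral_const_mul _ ((hprod s).comp measurable_updateFinset)
  rcases isEmpty_or_nonempty (∀ i, F i) with h | ⟨⟨y⟩⟩
  · obtain ⟨i, hi⟩ := isEmpty_pi.1 h
    rw [lintegral_of_isEmpty, Finset.prod_eq_zero (Finset.mem_univ i) (lintegral_of_isEmpty _ _)]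
  · rw [lintegral_eq_lmarginal_univ y, hmarginal]

lemma pi_withDensity (μ : ∀ i, Measure (F i)) [∀ i, SigmaFinite (μ i)] {f : ∀ i, F i → ℝ≥0∞}
    (hf : ∀ i, Measurable (f i)) [∀ i, SigmaFinite ((μ i).withDensity (f i))] :
    Measure.pi (fun i => (μ i).withDensity (f i))
      = (Measure.pi μ).withDensity (fun y => ∏ i, f i (y i)) := by
  refine Measure.pi_eq fun B hB => ?_
  rw [withDensity_apply _ (MeasurableSet.univ_pi hB),
    ← lintegral_indicator (MeasurableSet.univ_pi hB)]
  simp_rw [indicator_univ_pi_prod]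
  rw [lintegral_pi_prod μ fun i => (hf i).indicator (hB i)]
  exact Finset.prod_congr rfl fun i _ => by
    rw [lintegral_indicator (hB i), withDensity_apply _ (hB i)]

/-- Given a point `x`, independent draws from the laws `κ i x`. -/
def piKernel {S : Type*} [MeasurableSpace S] (κ : ∀ i, Kernel S (F i)) [∀ i, IsMarkovKernel (κ i)] :
    Kernel S (∀ i, F i) where
  toFun x := Measure.pi fun i => κ i x
  measurable' := by
    refine Measurable.measure_of_isPiSystem_of_isProbabilityMeasure generateFrom_pi.symm
      isPiSystem_pi ?_
    rintro _ ⟨B, hB, rfl⟩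
    simp_rw [Measure.pi_pi]
    exact Finset.measurable_fun_prod _ fun i _ => Kernel.measurable_coe (κ i) (hB i trivial)

variable {S : Type*} [MeasurableSpace S] (κ : ∀ i, Kernel S (F i)) [∀ i, IsMarkovKernel (κ i)]

lemma piKernel_apply (x : S) : piKernel κ x = Measure.pi fun i => κ i x := rfl

instance : IsMarkovKernel (piKernel κ) :=
  ⟨fun x => by rw [piKernel_apply]; infer_instance⟩

end Pi

section ConditionalLaw

variable {Ω S F : Type*} {m m₀ : MeasurableSpace Ω} [MeasurableSpace S] [MeasurableSpace F]
  {P : Measure Ω}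

lemma measure_inter_eq_setLIntegral_of_condExp [IsFiniteMeasure P] (hm : m ≤ m₀) {V : Set Ω}
    (hV : MeasurableSet V) {D : Set Ω} (hD : MeasurableSet[m] D) {g : Ω → ℝ}
    (hg : ∀ᵐ ω ∂P, ω ∈ D → (P[V.indicator fun _ => (1 : ℝ) | m]) ω = g ω) :
    P (D ∩ V) = ∫⁻ ω in D, ENNReal.ofReal (g ω) ∂P := by
  have hVint : Integrable (V.indicator fun _ => (1 : ℝ)) P := (integrable_const _).indicator hV
  have hnonneg : 0 ≤ᵐ[P] P[V.indicator fun _ => (1 : ℝ) | m] :=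
    condExp_nonneg (ae_of_all _ (Set.indicator_nonneg fun _ _ => zero_le_one))
  have hgD : ∀ᵐ ω ∂P, ω ∈ D → ENNReal.ofReal (g ω)
      = ENNReal.ofReal ((P[V.indicator fun _ => (1 : ℝ) | m]) ω) :=
    hg.mono fun ω h hω => by rw [h hω]
  rw [setLIntegral_congr_fun_ae (hm D hD) hgD,
    ← ofReal_integral_eq_lintegral_ofReal integrable_condExp.integrableOn
      (ae_restrict_of_ae hnonneg), setIntegral_condExp hm hVint hD, setIntegral_indicator hV,
    setIntegral_const, smul_eq_mul, mul_one, ofReal_measureReal]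

variable {U : Ω → S} {V : Ω → F} {κ : Kernel S F}

lemma hasCondDistrib_of_measure_inter [IsFiniteMeasure P] [IsSFiniteKernel κ]
    (hU : Measurable U) (hV : Measurable V) {C : Set (Set F)}
    (hC : MeasurableSpace.generateFrom C = ‹MeasurableSpace F›) (hpi : IsPiSystem C)
    (huniv : Set.univ ∈ C)
    (h : ∀ (D : Set S), MeasurableSet D → ∀ B ∈ C,
      P (U ⁻¹' D ∩ V ⁻¹' B) = ∫⁻ ω in U ⁻¹' D, κ (U ω) B ∂P) :
    HasCondDistrib V U κ P where
  aemeasurable := (hU.prodMk hV).aemeasurable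
  map_eq := by
    have hrect (D : Set S) (hD : MeasurableSet D) (B : Set F) (hB : B ∈ C) :
        P.map (fun ω => (U ω, V ω)) (D ×ˢ B) = (P.map U ⊗ₘ κ) (D ×ˢ B) := by
      have hBm : MeasurableSet B := hC ▸ MeasurableSpace.measurableSet_generateFrom hB
      rw [Measure.map_apply (hU.prodMk hV) (hD.prod hBm), Measure.compProd_apply_prod hD hBm,
        setLIntegral_map hD (κ.measurable_coe hBm) hU, ← h D hD B hB]
      rfl
    refine ext_of_generate_finite _ (generateFrom_eq_prod MeasurableSpace.generateFrom_measurableSet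
      hC isCountablySpanning_measurableSet ⟨fun _ => Set.univ, fun _ => huniv, Set.iUnion_const _⟩
      ).symm (MeasurableSpace.isPiSystem_measurableSet.prod hpi) ?_ ?_
    · rintro _ ⟨D, hD, B, hB, rfl⟩
      exact hrect D hD B hB
    · rw [← Set.univ_prod_univ]
      exact hrect _ .univ _ huniv

lemma hasCondDistrib_of_condExp [IsFiniteMeasure P] [IsMarkovKernel κ] (hm : m ≤ m₀)
    (hU : Measurable[m] U) (hV : Measurable V)
    (h : ∀ B, MeasurableSet B →
      P[(V ⁻¹' B).indicator fun _ => (1 : ℝ) | m] =ᵐ[P] fun ω => (κ (U ω)).real B) :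
    HasCondDistrib V U κ P := by
  refine hasCondDistrib_of_measure_inter (hU.mono hm le_rfl) hV
    MeasurableSpace.generateFrom_measurableSet MeasurableSpace.isPiSystem_measurableSet .univ
    fun D hD B hB => ?_
  rw [measure_inter_eq_setLIntegral_of_condExp hm (hV hB) (hU hD) ((h B hB).mono fun _ e _ => e)]
  exact lintegral_congr fun ω => ofReal_measureReal

lemma lintegral_of_hasCondDistrib [SFinite P] [IsSFiniteKernel κ] (h : HasCondDistrib V U κ P)
    {f : S × F → ℝ≥0∞} (hf : Measurable f) :
    ∫⁻ ω, f (U ω, V ω) ∂P = ∫⁻ ω, ∫⁻ v, f (U ω, v) ∂κ (U ω) ∂P := by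
  rw [← lintegral_map' hf.aemeasurable h.aemeasurable, h.map_eq, Measure.lintegral_compProd hf,
    lintegral_map' hf.lintegral_kernel_prod_right'.aemeasurable h.aemeasurable_fst]

lemma hasCondDistrib_comp [SFinite P] [IsSFiniteKernel κ] {G : Type*} [MeasurableSpace G]
    {W : Ω → G} {η : Kernel F G} [IsMarkovKernel η] (hV : HasCondDistrib V U κ P)
    (hW : HasCondDistrib W (fun ω => (U ω, V ω)) (η.prodMkLeft S) P) :
    HasCondDistrib W U (η ∘ₖ κ) P := by
  have hVW : HasCondDistrib (fun ω => (V ω, W ω)) U (κ ⊗ₖ η.prodMkLeft S) P := by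
    refine ⟨by have := hW.aemeasurable; fun_prop, ?_⟩
    rw [← Measure.compProd_assoc', ← hV.map_eq, ← hW.map_eq,
      AEMeasurable.map_map_of_aemeasurable (by fun_prop) hW.aemeasurable]
    rfl
  rw [Kernel.comp_eq_snd_compProd]
  exact hVW.snd

lemma hasCondDistrib_const [IsProbabilityMeasure P] {μ : Measure F} [SFinite μ]
    (hV : HasLaw V μ P) (s : S) : HasCondDistrib V (fun _ => s) (Kernel.const S μ) P where
  aemeasurable := aemeasurable_const.prodMk hV.aemeasurable
  map_eq := by
    rw [Measure.compProd_const, Measure.map_const, measure_univ, one_smul, Measure.dirac_prod,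
      ← hV.map_eq, AEMeasurable.map_map_of_aemeasurable (by fun_prop) hV.aemeasurable]
    rfl

end ConditionalLaw

section ConditionalProductLaw

variable {Ω S ι : Type*} {m₀ : MeasurableSpace Ω} [MeasurableSpace S] {F : ι → Type*}
  [∀ i, MeasurableSpace (F i)] {P : Measure Ω} [IsFiniteMeasure P]
  {m : ι → MeasurableSpace Ω} {U : Ω → S} {V : ∀ i, Ω → F i} {κ : ∀ i, Kernel S (F i)}
  [∀ i, IsMarkovKernel (κ i)]

-- Replacing the factors `1_{B i}(V i)` by `κ i U (B i)` one at a time only uses the conditional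
-- law of `V i` given `U` and the remaining factors.
lemma lintegral_mul_prod_indicator_of_condExp (hm : ∀ i, m i ≤ m₀) (hU : ∀ i, Measurable[m i] U)
    (hV₀ : ∀ i, Measurable (V i)) (hV : ∀ i j, j ≠ i → Measurable[m i] (V j))
    (h : ∀ i B, MeasurableSet B →
      P[(V i ⁻¹' B).indicator fun _ => (1 : ℝ) | m i] =ᵐ[P] fun ω => (κ i (U ω)).real B)
    {B : ∀ i, Set (F i)} (hB : ∀ i, MeasurableSet (B i)) (s : Finset ι) {g : S → ℝ≥0∞}
    (hg : Measurable g) :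
    ∫⁻ ω, g (U ω) * ∏ i ∈ s, (B i).indicator 1 (V i ω) ∂P
      = ∫⁻ ω, g (U ω) * ∏ i ∈ s, κ i (U ω) (B i) ∂P := by
  classical
  induction s using Finset.induction_on generalizing g with
  | empty => rfl
  | insert i s hi ih =>
    have hfactors : Measurable[m i] fun ω =>
        (U ω, ∏ j ∈ s, (B j).indicator (1 : F j → ℝ≥0∞) (V j ω)) :=
      (hU i).prodMk (Finset.measurable_fun_prod s fun j hj =>
        (measurable_one.indicator (hB j)).comp (hV i j (ne_of_mem_of_not_mem hj hi)))
    have hlaw : HasCondDistrib (V i)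
        (fun ω => (U ω, ∏ j ∈ s, (B j).indicator (1 : F j → ℝ≥0∞) (V j ω)))
        ((κ i).comap Prod.fst measurable_fst) P :=
      hasCondDistrib_of_condExp (hm i) hfactors (hV₀ i) (h i)
    have hreplace := lintegral_of_hasCondDistrib hlaw
      (f := fun p => g p.1.1 * p.1.2 * (B i).indicator 1 p.2) ((by fun_prop :
        Measurable fun p : (S × ℝ≥0∞) × F i => g p.1.1 * p.1.2).mul
          ((measurable_one.indicator (hB i)).comp measurable_snd))
    have hlast (ω : Ω) (c : ℝ≥0∞) :
        ∫⁻ v, g (U ω) * c * (B i).indicator 1 v ∂κ i (U ω) = g (U ω) * κ i (U ω) (B i) * c := by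
      rw [lintegral_const_mul _ (measurable_one.indicator (hB i)), lintegral_indicator_one (hB i)]
      ring
    simp only [Kernel.comap_apply, hlast] at hreplace
    calc ∫⁻ ω, g (U ω) * ∏ j ∈ insert i s, (B j).indicator 1 (V j ω) ∂P
      _ = ∫⁻ ω, g (U ω) * (∏ j ∈ s, (B j).indicator 1 (V j ω)) * (B i).indicator 1 (V i ω) ∂P := by
        simp_rw [Finset.prod_insert hi, mul_assoc, mul_comm ((B i).indicator _ _)]
      _ = ∫⁻ ω, g (U ω) * κ i (U ω) (B i) * ∏ j ∈ s, κ j (U ω) (B j) ∂P :=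
        hreplace.trans (ih (hg.mul ((κ i).measurable_coe (hB i))))
      _ = _ := by simp_rw [Finset.prod_insert hi, mul_assoc]

variable [Fintype ι]

lemma hasCondDistrib_pi_of_condExp (hm : ∀ i, m i ≤ m₀) (hU₀ : Measurable U)
    (hU : ∀ i, Measurable[m i] U) (hV₀ : ∀ i, Measurable (V i))
    (hV : ∀ i j, j ≠ i → Measurable[m i] (V j))
    (h : ∀ i B, MeasurableSet B →
      P[(V i ⁻¹' B).indicator fun _ => (1 : ℝ) | m i] =ᵐ[P] fun ω => (κ i (U ω)).real B) :
    HasCondDistrib (fun ω i => V i ω) U (piKernel κ) P := by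
  refine hasCondDistrib_of_measure_inter hU₀ (measurable_pi_lambda _ hV₀) generateFrom_pi
    isPiSystem_pi ⟨fun _ => Set.univ, fun _ _ => .univ, Set.pi_univ _⟩ ?_
  rintro D hD _ ⟨B, hB, rfl⟩
  have hBm (i : ι) : MeasurableSet (B i) := hB i trivial
  have hV' : Measurable fun ω i => V i ω := measurable_pi_lambda _ hV₀
  have hindicator (ω : Ω) : (U ⁻¹' D ∩ (fun ω i => V i ω) ⁻¹' Set.univ.pi B).indicator 1 ω
      = D.indicator (1 : S → ℝ≥0∞) (U ω) * ∏ i, (B i).indicator (1 : F i → ℝ≥0∞) (V i ω) := by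
    rw [Set.inter_indicator_one, Pi.mul_apply,
      ← indicator_univ_pi_prod B (fun _ => 1) (fun i => V i ω)]
    simp only [Pi.one_apply, Finset.prod_const_one]
    rfl
  rw [← lintegral_indicator_one ((hU₀ hD).inter (hV' (MeasurableSet.univ_pi hBm))),
    ← lintegral_indicator (hU₀ hD)]
  simp_rw [hindicator]
  rw [lintegral_mul_prod_indicator_of_condExp hm hU hV₀ hV h hBm Finset.univ
    (measurable_one.indicator hD)]
  refine lintegral_congr fun ω => ?_
  by_cases hω : U ω ∈ D <;> simp [hω, piKernel_apply, Measure.pi_pi]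

end ConditionalProductLaw

section BayesUpdate

variable {E : Type*} [MeasurableSpace E]

/-- The posterior of the prior `μ` for the likelihood `g`, that is `μ` reweighted by `g` and
normalized. It is a junk value if the normalizing constant is `0` or `∞`. -/
def bayesUpdate (μ : Measure E) (g : E → ℝ≥0) : Measure E :=
  μ.withDensity fun x => (g x : ℝ≥0∞) / ∫⁻ x', g x' ∂μ

lemma bayesUpdate_absolutelyContinuous (μ : Measure E) (g : E → ℝ≥0) : bayesUpdate μ g ≪ μ :=
  withDensity_absolutelyContinuous _ _

lemma bayesUpdate_apply {μ : Measure E} {g : E → ℝ≥0} (hg : Measurable g) {B : Set E}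
    (hB : MeasurableSet B) :
    bayesUpdate μ g B = (∫⁻ x in B, g x ∂μ) / ∫⁻ x, g x ∂μ := by
  simp_rw [bayesUpdate, withDensity_apply _ hB, div_eq_mul_inv]
  exact lintegral_mul_const _ hg.coe_nnreal_ennreal

lemma integral_bayesUpdate {μ : Measure E} {g : E → ℝ≥0} (hg : Measurable g)
    (h0 : ∫⁻ x, g x ∂μ ≠ 0) (φ : E → ℝ) :
    ∫ x, φ x ∂bayesUpdate μ g = (∫ x, g x * φ x ∂μ) / ∫ x, (g x : ℝ) ∂μ := by
  have hZ : (∫⁻ x, g x ∂μ).toReal = ∫ x, (g x : ℝ) ∂μ := by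
    rw [integral_eq_lintegral_of_nonneg_ae (ae_of_all _ fun x => (g x).coe_nonneg) (by fun_prop)]
    simp
  rw [bayesUpdate, integral_withDensity_eq_integral_toReal_smul (by fun_prop)
    (ae_of_all _ fun x => ENNReal.div_lt_top ENNReal.coe_ne_top h0), ← integral_div, ← hZ]
  simp only [ENNReal.toReal_div, ENNReal.coe_toReal, smul_eq_mul, div_mul_eq_mul_div]

lemma integrable_bayesUpdate {μ : Measure E} {g : E → ℝ≥0} (hg : Measurable g)
    (h0 : ∫⁻ x, g x ∂μ ≠ 0) {φ : E → ℝ} (hφ : Integrable (fun x => g x * φ x) μ) :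
    Integrable φ (bayesUpdate μ g) := by
  rw [bayesUpdate, integrable_withDensity_iff_integrable_smul' (by fun_prop)
    (ae_of_all _ fun x => ENNReal.div_lt_top ENNReal.coe_ne_top h0)]
  refine (hφ.div_const (∫⁻ x, g x ∂μ).toReal).congr (ae_of_all _ fun x => ?_)
  simp only [ENNReal.toReal_div, ENNReal.coe_toReal, smul_eq_mul, div_mul_eq_mul_div]

lemma bayesUpdate_univ_le (μ : Measure E) {g : E → ℝ≥0} (hg : Measurable g) :
    bayesUpdate μ g Set.univ ≤ 1 := by
  rw [bayesUpdate_apply hg .univ, setLIntegral_univ]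
  exact ENNReal.div_self_le_one

variable {S : Type*} [MeasurableSpace S]

lemma measurable_setLIntegral_kernel (κ : Kernel S E) [IsSFiniteKernel κ] {g : S → E → ℝ≥0}
    (hg : Measurable (Function.uncurry g)) {B : Set E} (hB : MeasurableSet B) :
    Measurable fun s => ∫⁻ x in B, g s x ∂κ s := by
  simp_rw [← Kernel.restrict_apply κ hB]
  exact Measurable.lintegral_kernel_prod_right' (κ := κ.restrict hB) hg.coe_nnreal_ennreal

/-- The map `s ↦ bayesUpdate (κ s) (g s)` as a kernel. -/
def bayesKernel (κ : Kernel S E) [IsSFiniteKernel κ] {g : S → E → ℝ≥0}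
    (hg : Measurable (Function.uncurry g)) : Kernel S E where
  toFun s := bayesUpdate (κ s) (g s)
  measurable' := by
    refine Measure.measurable_of_measurable_coe _ fun B hB => ?_
    have happly (s : S) : bayesUpdate (κ s) (g s) B = (∫⁻ x in B, g s x ∂κ s) / ∫⁻ x, g s x ∂κ s :=
      bayesUpdate_apply (hg.comp measurable_prodMk_left) hB
    simp_rw [happly]
    exact (measurable_setLIntegral_kernel κ hg hB).div
      (by simpa using measurable_setLIntegral_kernel κ hg .univ)

instance (κ : Kernel S E) [IsSFiniteKernel κ] {g : S → E → ℝ≥0}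
    (hg : Measurable (Function.uncurry g)) : IsFiniteKernel (bayesKernel κ hg) :=
  ⟨1, ENNReal.one_lt_top, fun _ => bayesUpdate_univ_le _ (hg.comp measurable_prodMk_left)⟩

end BayesUpdate

section Bayes

variable {Ω S 𝒴 E : Type*} [MeasurableSpace Ω] [MeasurableSpace S] [MeasurableSpace 𝒴]
  [MeasurableSpace E] {P : Measure Ω} {H : Ω → S} {V : Ω → 𝒴} {X : Ω → E} {ρ : Measure 𝒴}
  {η : Kernel S E} [IsSFiniteKernel η] {κ : Kernel E 𝒴} [IsSFiniteKernel κ] {g : 𝒴 → E → ℝ≥0}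

lemma lintegral_eq_lintegral_likelihood [SFinite P] [SFinite ρ]
    (hX : HasCondDistrib X H η P) (hV : HasCondDistrib V (fun ω => (H ω, X ω)) (κ.prodMkLeft S) P)
    (hg : Measurable (Function.uncurry g))
    (hκ : ∀ᵐ ω ∂P, κ (X ω) = ρ.withDensity fun v => (g v (X ω) : ℝ≥0∞))
    {f : (S × 𝒴) × E → ℝ≥0∞} (hf : Measurable f) :
    ∫⁻ ω, f ((H ω, V ω), X ω) ∂P
      = ∫⁻ p, ∫⁻ x, g p.2 x * f (p, x) ∂η p.1 ∂((P.map H).prod ρ) := by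
  have hG : Measurable fun q : (S × 𝒴) × E => g q.1.2 q.2 * f q :=
    (hg.coe_nnreal_ennreal.comp (by fun_prop : Measurable fun q : (S × 𝒴) × E => (q.1.2, q.2))).mul
      hf
  have hGx : Measurable fun p : S × 𝒴 => ∫⁻ x, g p.2 x * f (p, x) ∂η p.1 :=
    hG.lintegral_kernel_prod_right' (κ := η.prodMkRight 𝒴)
  calc ∫⁻ ω, f ((H ω, V ω), X ω) ∂P
    _ = ∫⁻ ω, ∫⁻ v, f ((H ω, v), X ω) ∂κ (X ω) ∂P :=
      lintegral_of_hasCondDistrib hV (f := fun q => f ((q.1.1, q.2), q.1.2)) (by fun_prop)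
    _ = ∫⁻ ω, ∫⁻ v, g v (X ω) * f ((H ω, v), X ω) ∂ρ ∂P := by
      refine lintegral_congr_ae (hκ.mono fun ω hω => ?_)
      have hgω : Measurable fun v => (g v (X ω) : ℝ≥0∞) :=
        (hg.comp measurable_prodMk_right).coe_nnreal_ennreal
      beta_reduce
      rw [hω, lintegral_withDensity_eq_lintegral_mul _ hgω (by fun_prop)]
      rfl
    _ = ∫⁻ ω, ∫⁻ x, ∫⁻ v, g v x * f ((H ω, v), x) ∂ρ ∂η (H ω) ∂P :=
      lintegral_of_hasCondDistrib hX (f := fun q => ∫⁻ v, g v q.2 * f ((q.1, v), q.2) ∂ρ)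
        (Measurable.lintegral_prod_right' (f := fun r : (S × E) × 𝒴 =>
          g r.2 r.1.2 * f ((r.1.1, r.2), r.1.2)) (hG.comp (by fun_prop :
            Measurable fun r : (S × E) × 𝒴 => ((r.1.1, r.2), r.1.2))))
    _ = ∫⁻ ω, ∫⁻ v, ∫⁻ x, g v x * f ((H ω, v), x) ∂η (H ω) ∂ρ ∂P :=
      lintegral_congr fun ω => lintegral_lintegral_swap (hG.comp (by fun_prop :
        Measurable fun q : E × 𝒴 => ((H ω, q.2), q.1))).aemeasurable
    _ = ∫⁻ p, ∫⁻ x, g p.2 x * f (p, x) ∂η p.1 ∂((P.map H).prod ρ) := by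
      rw [lintegral_prod _ hGx.aemeasurable,
        lintegral_map' hGx.lintegral_prod_right'.aemeasurable hX.aemeasurable_fst]

lemma map_prodMk_eq_withDensity [SFinite P] [SFinite ρ] (hX : HasCondDistrib X H η P)
    (hV : HasCondDistrib V (fun ω => (H ω, X ω)) (κ.prodMkLeft S) P)
    (hg : Measurable (Function.uncurry g))
    (hκ : ∀ᵐ ω ∂P, κ (X ω) = ρ.withDensity fun v => (g v (X ω) : ℝ≥0∞)) :
    P.map (fun ω => (H ω, V ω))
      = ((P.map H).prod ρ).withDensity fun p => ∫⁻ x, g p.2 x ∂η p.1 := by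
  have hHV : AEMeasurable (fun ω => (H ω, V ω)) P :=
    hX.aemeasurable_fst.prodMk hV.aemeasurable_snd
  ext D hD
  have hDind : Measurable (D.indicator (1 : S × 𝒴 → ℝ≥0∞)) := measurable_one.indicator hD
  rw [withDensity_apply _ hD, ← lintegral_indicator_one hD, ← lintegral_indicator hD,
    lintegral_map' hDind.aemeasurable hHV, lintegral_eq_lintegral_likelihood hX hV hg hκ
      (f := fun q => D.indicator 1 q.1) (hDind.comp measurable_fst)]
  refine lintegral_congr fun p => ?_
  by_cases hp : p ∈ D <;> simp [hp]

lemma measurable_uncurry_snd (S : Type*) [MeasurableSpace S]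
    (hg : Measurable (Function.uncurry g)) :
    Measurable (Function.uncurry fun p : S × 𝒴 => g p.2) :=
  hg.comp (measurable_fst.snd.prodMk measurable_snd)

lemma measurable_normalizer (hg : Measurable (Function.uncurry g)) :
    Measurable fun p : S × 𝒴 => ∫⁻ x, g p.2 x ∂η p.1 := by
  simpa using measurable_setLIntegral_kernel (η.prodMkRight 𝒴) (measurable_uncurry_snd S hg) .univ

variable [IsFiniteMeasure P] [SFinite ρ]

lemma ae_normalizer_ne_top
    (hX : HasCondDistrib X H η P) (hV : HasCondDistrib V (fun ω => (H ω, X ω)) (κ.prodMkLeft S) P)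
    (hg : Measurable (Function.uncurry g))
    (hκ : ∀ᵐ ω ∂P, κ (X ω) = ρ.withDensity fun v => (g v (X ω) : ℝ≥0∞)) :
    ∀ᵐ p ∂(P.map H).prod ρ, ∫⁻ x, g p.2 x ∂η p.1 ≠ ∞ := by
  have hfin : ∫⁻ p, ∫⁻ x, g p.2 x ∂η p.1 ∂((P.map H).prod ρ) ≠ ∞ := by
    rw [← setLIntegral_univ, ← withDensity_apply _ .univ, ← map_prodMk_eq_withDensity hX hV hg hκ]
    exact measure_ne_top _ _
  exact (ae_lt_top (measurable_normalizer hg) hfin).mono fun _ hp => hp.ne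

lemma ae_normalizer_ne_zero_and_ne_top
    (hX : HasCondDistrib X H η P) (hV : HasCondDistrib V (fun ω => (H ω, X ω)) (κ.prodMkLeft S) P)
    (hg : Measurable (Function.uncurry g))
    (hκ : ∀ᵐ ω ∂P, κ (X ω) = ρ.withDensity fun v => (g v (X ω) : ℝ≥0∞)) :
    ∀ᵐ ω ∂P, ∫⁻ x, g (V ω) x ∂η (H ω) ≠ 0 ∧ ∫⁻ x, g (V ω) x ∂η (H ω) ≠ ∞ := by
  have hlaw : ∀ᵐ p ∂P.map (fun ω => (H ω, V ω)),
      ∫⁻ x, g p.2 x ∂η p.1 ≠ 0 ∧ ∫⁻ x, g p.2 x ∂η p.1 ≠ ∞ := by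
    rw [map_prodMk_eq_withDensity hX hV hg hκ]
    exact ((ae_withDensity_iff (measurable_normalizer hg)).2 (ae_of_all _ fun _ hp => hp)).and
      ((withDensity_absolutelyContinuous _ _).ae_le (ae_normalizer_ne_top hX hV hg hκ))
  exact ae_of_ae_map (hX.aemeasurable_fst.prodMk hV.aemeasurable_snd) hlaw

lemma hasCondDistrib_bayesKernel (hH : Measurable H) (hVm : Measurable V) (hXm : Measurable X)
    (hX : HasCondDistrib X H η P) (hV : HasCondDistrib V (fun ω => (H ω, X ω)) (κ.prodMkLeft S) P)
    (hg : Measurable (Function.uncurry g))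
    (hκ : ∀ᵐ ω ∂P, κ (X ω) = ρ.withDensity fun v => (g v (X ω) : ℝ≥0∞)) :
    HasCondDistrib X (fun ω => (H ω, V ω))
      (bayesKernel (η.prodMkRight 𝒴) (measurable_uncurry_snd S hg)) P := by
  refine hasCondDistrib_of_measure_inter (hH.prodMk hVm) hXm
    MeasurableSpace.generateFrom_measurableSet MeasurableSpace.isPiSystem_measurableSet .univ
    fun D hD B hB => ?_
  set κ' := bayesKernel (η.prodMkRight 𝒴) (measurable_uncurry_snd S hg)
  have hκ'B (p : S × 𝒴) : κ' p B = (∫⁻ x in B, g p.2 x ∂η p.1) / ∫⁻ x, g p.2 x ∂η p.1 :=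
    bayesUpdate_apply (hg.comp measurable_prodMk_left) hB
  calc P ((fun ω => (H ω, V ω)) ⁻¹' D ∩ X ⁻¹' B)
    _ = ∫⁻ ω, (D ×ˢ B).indicator 1 ((H ω, V ω), X ω) ∂P := by
      rw [← lintegral_indicator_one ((hH.prodMk hVm hD).inter (hXm hB))]
      rfl
    _ = ∫⁻ p, ∫⁻ x, g p.2 x * (D ×ˢ B).indicator 1 (p, x) ∂η p.1 ∂((P.map H).prod ρ) :=
      lintegral_eq_lintegral_likelihood hX hV hg hκ (measurable_one.indicator (hD.prod hB))
    _ = ∫⁻ p in D, ∫⁻ x in B, g p.2 x ∂η p.1 ∂((P.map H).prod ρ) := by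
      rw [← lintegral_indicator hD]
      refine lintegral_congr fun p => ?_
      by_cases hp : p ∈ D
      · rw [Set.indicator_of_mem hp, ← lintegral_indicator hB]
        refine lintegral_congr fun x => ?_
        by_cases hx : x ∈ B <;> simp [hp, hx]
      · simp [hp]
    _ = ∫⁻ p in D, (∫⁻ x, g p.2 x ∂η p.1) * κ' p B ∂((P.map H).prod ρ) := by
      refine lintegral_congr_ae (ae_restrict_of_ae ?_)
      filter_upwards [ae_normalizer_ne_top hX hV hg hκ] with p hp
      rw [hκ'B, ENNReal.mul_div_cancel' (fun h => ?_) fun h => absurd h hp]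
      exact le_antisymm (h ▸ setLIntegral_le_lintegral B _) bot_le
    _ = ∫⁻ ω in (fun ω => (H ω, V ω)) ⁻¹' D, κ' (H ω, V ω) B ∂P := by
      rw [← setLIntegral_map hD (κ'.measurable_coe hB) (hH.prodMk hVm),
        map_prodMk_eq_withDensity hX hV hg hκ, setLIntegral_withDensity_eq_setLIntegral_mul _
          (measurable_normalizer hg) (κ'.measurable_coe hB) hD]
      rfl

end Bayes

section AllMoments

variable {E F : Type*} [MeasurableSpace E] [MeasurableSpace F] {μ : Measure E}

/-- All moments of `φ` under `μ` are finite. Unlike membership in a fixed `L^p` space this property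
is stable under products. -/
def AllMoments (φ : E → ℝ) (μ : Measure E) : Prop := ∀ p : ℕ, MemLp φ p μ

lemma AllMoments.mul {φ ψ : E → ℝ} (hφ : AllMoments φ μ) (hψ : AllMoments ψ μ) :
    AllMoments (fun x => φ x * ψ x) μ := by
  intro p
  have : ENNReal.HolderTriple ((2 * p : ℕ) : ℝ≥0∞) ((2 * p : ℕ) : ℝ≥0∞) p := by
    constructor
    push_cast
    rw [ENNReal.mul_inv (by simp) (by simp), ← add_mul, ENNReal.inv_two_add_inv_two, one_mul]
  exact MemLp.mul' (hψ (2 * p)) (hφ (2 * p))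

lemma AllMoments.finset_prod [IsFiniteMeasure μ] {ι : Type*} {φ : ι → E → ℝ} (s : Finset ι)
    (h : ∀ i ∈ s, AllMoments (φ i) μ) : AllMoments (fun x => ∏ i ∈ s, φ i x) μ := by
  classical
  induction s using Finset.induction_on with
  | empty => exact fun p => by simpa using memLp_const (1 : ℝ)
  | insert a s ha ih =>
    simp only [Finset.prod_insert ha]
    exact (h a (Finset.mem_insert_self a s)).mul
      (ih fun i hi => h i (Finset.mem_insert_of_mem hi))

lemma AllMoments.pow [IsFiniteMeasure μ] {φ : E → ℝ} (hφ : AllMoments φ μ) (n : ℕ) :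
    AllMoments (fun x => φ x ^ n) μ := by
  simpa using AllMoments.finset_prod (Finset.range n) fun _ _ => hφ

lemma AllMoments.integrable {φ : E → ℝ} (hφ : AllMoments φ μ) : Integrable φ μ :=
  memLp_one_iff_integrable.1 (by simpa using hφ 1)

lemma enorm_integral_pow_le [IsProbabilityMeasure μ] {φ : E → ℝ} (hφ : Measurable φ) {p : ℕ}
    (hp : p ≠ 0) : ‖∫ x, φ x ∂μ‖ₑ ^ p ≤ ∫⁻ x, ‖φ x‖ₑ ^ p ∂μ := by
  have hp1 : (1 : ℝ≥0∞) ≤ p := by exact_mod_cast Nat.one_le_iff_ne_zero.2 hp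
  have hnorm : ‖∫ x, φ x ∂μ‖ₑ ≤ eLpNorm φ p μ := by
    refine (enorm_integral_le_lintegral_enorm φ).trans ?_
    rw [← eLpNorm_one_eq_lintegral_enorm]
    exact eLpNorm_le_eLpNorm_of_exponent_le hp1 hφ.aestronglyMeasurable
  refine (pow_le_pow_left' hnorm p).trans_eq ?_
  rw [eLpNorm_eq_lintegral_rpow_enorm_toReal (by exact_mod_cast hp) (by simp)]
  simp only [ENNReal.toReal_natCast, ENNReal.rpow_natCast]
  rw [← ENNReal.rpow_natCast, ← ENNReal.rpow_mul, one_div,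
    inv_mul_cancel₀ (by exact_mod_cast hp), ENNReal.rpow_one]

lemma measurable_integral_kernel (κ : Kernel E F) {φ : F → ℝ} (hφ : Measurable φ) :
    Measurable fun x => ∫ z, φ z ∂κ x :=
  hφ.stronglyMeasurable.integral_kernel.measurable

lemma AllMoments.integral_kernel {κ : Kernel E F} [IsMarkovKernel κ] {φ : F → ℝ}
    (hφm : Measurable φ) (hφ : AllMoments φ (μ.bind κ)) :
    AllMoments (fun x => ∫ z, φ z ∂κ x) μ := by
  intro p
  have hm := measurable_integral_kernel κ hφm
  rcases eq_or_ne p 0 with rfl | hp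
  · simpa using hm.aestronglyMeasurable
  rw [memLp_natCast_iff hm hp]
  refine (lintegral_mono fun x => enorm_integral_pow_le hφm hp).trans_lt ?_
  rw [← Measure.lintegral_bind κ.aemeasurable (by fun_prop)]
  exact (memLp_natCast_iff hφm hp).1 (hφ p)

end AllMoments

section PredictiveLaw

variable {E : ℕ → Type*} [∀ t, MeasurableSpace (E t)]

/-- The law at time `t` of the Markov chain with initial law `μ` and transition kernels `κ`. -/
def markovLaw (μ : Measure (E 0)) (κ : ∀ t, Kernel (E t) (E (t + 1))) : ∀ t, Measure (E t)
  | 0 => μ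
  | t + 1 => (markovLaw μ κ t).bind (κ t)

/-- The predictive law at time `t` of the hidden Markov model with initial law `μ`, transition
kernels `κ` and likelihoods `g`: the law of the state at time `t` given the observations at all
earlier times. The observations enter only through their likelihoods. -/
def predLaw (μ : Measure (E 0)) (κ : ∀ t, Kernel (E t) (E (t + 1))) (g : ∀ t, E t → ℝ≥0) :
    ∀ t, Measure (E t)
  | 0 => μ
  | t + 1 => (bayesUpdate (predLaw μ κ g t) (g t)).bind (κ t)

variable {μ : Measure (E 0)} {κ : ∀ t, Kernel (E t) (E (t + 1))} {g : ∀ t, E t → ℝ≥0}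

instance [IsProbabilityMeasure μ] [∀ t, IsMarkovKernel (κ t)] (t : ℕ) :
    IsProbabilityMeasure (markovLaw μ κ t) := by
  induction t with
  | zero => assumption
  | succ t ih => exact inferInstanceAs (IsProbabilityMeasure ((markovLaw μ κ t).bind (κ t)))

lemma predLaw_absolutelyContinuous (t : ℕ) : predLaw μ κ g t ≪ markovLaw μ κ t := by
  induction t with
  | zero => exact .rfl
  | succ t ih =>
    exact ((bayesUpdate_absolutelyContinuous _ _).trans ih).comp_right _

variable [∀ t, IsMarkovKernel (κ t)] {T : ℕ}

lemma integrable_predLaw (hg : ∀ t, Measurable (g t))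
    (hgm : ∀ t ≤ T, AllMoments (fun x => (g t x : ℝ)) (markovLaw μ κ t))
    (hZ : ∀ t ≤ T, ∫⁻ x, g t x ∂predLaw μ κ g t ≠ 0) {t : ℕ} (ht : t ≤ T) {φ : E t → ℝ}
    (hφm : Measurable φ) (hφ : AllMoments φ (markovLaw μ κ t)) :
    Integrable φ (predLaw μ κ g t) := by
  induction t with
  | zero => exact hφ.integrable
  | succ t ih =>
    have ht' : t ≤ T := by omega
    have hint : Integrable φ (κ t ∘ₘ markovLaw μ κ t) := hφ.integrable
    refine (Measure.integrable_comp_iff hφm.aestronglyMeasurable).2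
      ⟨?_, integrable_bayesUpdate (hg t) (hZ t ht') ?_⟩
    · exact ((bayesUpdate_absolutelyContinuous _ _).trans
        (predLaw_absolutelyContinuous t)).ae_le
          ((Measure.integrable_comp_iff hφm.aestronglyMeasurable).1 hint).1
    · have hnorm : AllMoments (fun z => ‖φ z‖) ((markovLaw μ κ t).bind (κ t)) :=
        fun p => (hφ p).norm
      exact ih ht' ((hg t).coe_nnreal_real.mul (measurable_integral_kernel _ hφm.norm))
        ((hgm t ht').mul (hnorm.integral_kernel hφm.norm))

lemma integral_predLaw_pos (hg : ∀ t, Measurable (g t))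
    (hgm : ∀ t ≤ T, AllMoments (fun x => (g t x : ℝ)) (markovLaw μ κ t))
    (hZ : ∀ t ≤ T, ∫⁻ x, g t x ∂predLaw μ κ g t ≠ 0) {t : ℕ} (ht : t ≤ T) :
    0 < ∫ x, (g t x : ℝ) ∂predLaw μ κ g t := by
  have hint := integrable_predLaw hg hgm hZ ht (hg t).coe_nnreal_real (hgm t ht)
  rw [integral_pos_iff_support_of_nonneg (fun x => NNReal.coe_nonneg _) hint]
  refine pos_iff_ne_zero.2 fun h => hZ t ht (lintegral_eq_zero_of_ae_eq_zero ?_)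
  filter_upwards [measure_eq_zero_iff_ae_notMem.1 h] with x hx
  simpa using hx

lemma integral_predLaw_succ (hg : ∀ t, Measurable (g t))
    (hgm : ∀ t ≤ T, AllMoments (fun x => (g t x : ℝ)) (markovLaw μ κ t))
    (hZ : ∀ t ≤ T, ∫⁻ x, g t x ∂predLaw μ κ g t ≠ 0) {t : ℕ} (ht : t < T) {φ : E (t + 1) → ℝ}
    (hφm : Measurable φ) (hφ : AllMoments φ (markovLaw μ κ (t + 1))) :
    ∫ z, φ z ∂predLaw μ κ g (t + 1)
      = (∫ x, g t x * ∫ z, φ z ∂κ t x ∂predLaw μ κ g t) / ∫ x, (g t x : ℝ) ∂predLaw μ κ g t := by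
  rw [← integral_bayesUpdate (hg t) (hZ t ht.le)]
  have hint :
      Integrable φ ((κ t ∘ₖ Kernel.const Unit (bayesUpdate (predLaw μ κ g t) (g t))) ()) := by
    rw [Kernel.comp_apply, Kernel.const_apply]
    exact integrable_predLaw hg hgm hZ ht hφm hφ
  simpa only [Kernel.comp_apply, Kernel.const_apply] using! Kernel.integral_comp hint

end PredictiveLaw

section AtomRef

/-- The sum of the counting measure on `A` and Lebesgue measure, a common reference measure for
the mixtures whose atoms lie in `A`. -/
def atomRef (A : Set ℝ) : Measure ℝ := Measure.sum (fun a : A => Measure.dirac (a : ℝ)) + volume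

lemma sigmaFinite_atomRef {A : Set ℝ} (hA : A.Countable) : SigmaFinite (atomRef A) := by
  have hsum : SigmaFinite (Measure.sum fun a : A => Measure.dirac (a : ℝ)) := by
    refine Measure.sigmaFinite_of_countable ((hA.image fun a => ({a} : Set ℝ)).insert Aᶜ) ?_ ?_
    · rintro s (rfl | ⟨a, ha, rfl⟩)
      · rw [Measure.sum_apply _ hA.measurableSet.compl]
        simp
      · rw [Measure.sum_apply _ (measurableSet_singleton a), tsum_eq_single ⟨a, ha⟩]
        · simp
        · rintro b hb
          simp [show (b : ℝ) ≠ a from fun h => hb (Subtype.ext h)]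
    · ext y
      simp
  exact inferInstanceAs (SigmaFinite (_ + volume))

end AtomRef

namespace MixedSSM

section Likelihood

variable {E : ℕ → Type*} [∀ t, MeasurableSpace (E t)] {m : ℕ → ℕ} (M : MixedSSM E m)

instance : IsProbabilityMeasure M.init := M.isProb_init

instance (t : ℕ) : IsMarkovKernel (M.trans t) := M.isMarkov_trans t

instance (t : ℕ) (i : Fin (m t)) : IsMarkovKernel (M.obs t i) := M.isMarkov_obs t i

lemma obs_singleton (t : ℕ) (i : Fin (m t)) (x : E t) (y : ℝ) :
    M.obs t i x {y} = M.mass t i x y := by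
  rw [M.obs_eq, Measure.add_apply, Measure.sum_apply _ (measurableSet_singleton y),
    withDensity_absolutelyContinuous volume _ Real.volume_singleton, add_zero, tsum_eq_single y]
  · simp
  · rintro z hz
    simp [hz]

lemma mass_le_one (t : ℕ) (i : Fin (m t)) (x : E t) (y : ℝ) : M.mass t i x y ≤ 1 := by
  have h : M.obs t i x {y} ≤ 1 := prob_le_one
  rw [obs_singleton] at h
  exact_mod_cast h

lemma measurable_mass (t : ℕ) (i : Fin (m t)) (y : ℝ) : Measurable fun x => M.mass t i x y := by
  have h := (M.obs t i).measurable_coe (measurableSet_singleton y)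
  simp_rw [obs_singleton] at h
  simpa using h.ennreal_toNNReal

open Classical in
/-- The density of `Y_{t,i}` given `X_t = x` with respect to `atomRef A`. -/
def coordLik (A : Set ℝ) (t : ℕ) (i : Fin (m t)) (y : ℝ) (x : E t) : ℝ≥0 :=
  if y ∈ A then M.mass t i x y else M.dens t i x y

lemma measurable_coordLik {A : Set ℝ} (hA : A.Countable) (t : ℕ) (i : Fin (m t)) :
    Measurable (Function.uncurry (M.coordLik A t i)) := by
  intro B hB
  have hpreimage : Function.uncurry (M.coordLik A t i) ⁻¹' B
      = (⋃ a ∈ A, {p : ℝ × E t | p.1 = a ∧ M.mass t i p.2 a ∈ B}) ∪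
        {p : ℝ × E t | p.1 ∉ A ∧ M.dens t i p.2 p.1 ∈ B} := by
    ext ⟨y, x⟩
    by_cases hy : y ∈ A <;> simp [coordLik, Function.uncurry, hy]
  rw [hpreimage]
  refine (MeasurableSet.biUnion hA fun a _ => ?_).union ?_
  · exact (measurable_fst (measurableSet_singleton a)).inter
      (((M.measurable_mass t i a).comp measurable_snd) hB)
  · exact (measurable_fst hA.measurableSet.compl).inter
      (((M.measurable_dens t i).comp measurable_swap) hB)

lemma obs_eq_withDensity {A : Set ℝ} (hA : A.Countable) {t : ℕ} {i : Fin (m t)} {x : E t}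
    (hx : ∀ y, y ∉ A → M.mass t i x y = 0) :
    M.obs t i x = (atomRef A).withDensity fun y => M.coordLik A t i y x := by
  rw [M.obs_eq, atomRef, withDensity_add_measure]
  congr 1
  · ext B hB
    rw [Measure.sum_apply _ hB, withDensity_apply _ hB, ← lintegral_indicator hB,
      lintegral_sum_measure, ← tsum_subtype_eq_of_support_subset (s := A)]
    · refine tsum_congr fun a => ?_
      rw [lintegral_dirac]
      by_cases h : (a : ℝ) ∈ B <;> simp [h, coordLik]
    · intro y hy
      by_contra h
      exact hy (by simp [hx y h])
  · refine withDensity_congr_ae ?_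
    filter_upwards [measure_eq_zero_iff_ae_notMem.1 (hA.measure_zero volume)] with y hy
    simp [coordLik, hy]

/-- The density of `Y_t` given `X_t = x` with respect to the product of the measures
`atomRef (A t i)`. -/
def lik (A : ∀ t, Fin (m t) → Set ℝ) (t : ℕ) (y : Fin (m t) → ℝ) (x : E t) : ℝ≥0 :=
  ∏ i, M.coordLik (A t i) t i (y i) x

variable {A : ∀ t, Fin (m t) → Set ℝ}

lemma measurable_lik (hA : ∀ t i, (A t i).Countable) (t : ℕ) :
    Measurable (Function.uncurry (M.lik A t)) := by
  simp_rw [Function.uncurry_def, lik]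
  exact Finset.measurable_fun_prod _ fun i _ => (M.measurable_coordLik (hA t i) t i).comp
    (by fun_prop : Measurable fun p : (Fin (m t) → ℝ) × E t => (p.1 i, p.2))

lemma measurable_lik_apply (hA : ∀ t i, (A t i).Countable) (t : ℕ) (y : Fin (m t) → ℝ) :
    Measurable (M.lik A t y) :=
  (M.measurable_lik hA t).comp measurable_prodMk_left

lemma piKernel_obs_eq_withDensity (hA : ∀ t i, (A t i).Countable) {t : ℕ} {x : E t}
    (hx : ∀ i y, y ∉ A t i → M.mass t i x y = 0) :
    piKernel (M.obs t) x
      = (Measure.pi fun i => atomRef (A t i)).withDensity fun y => M.lik A t y x := by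
  have (i : Fin (m t)) : SigmaFinite (atomRef (A t i)) := sigmaFinite_atomRef (hA t i)
  have hobs (i : Fin (m t)) := M.obs_eq_withDensity (hA t i) (hx i)
  have (i : Fin (m t)) : SigmaFinite
      ((atomRef (A t i)).withDensity fun y => (M.coordLik (A t i) t i y x : ℝ≥0∞)) := by
    rw [← hobs]
    infer_instance
  simp_rw [piKernel_apply, hobs, lik, ENNReal.ofNNReal_finsetProd]
  exact pi_withDensity _ fun i =>
    ((M.measurable_coordLik (hA t i) t i).comp measurable_prodMk_right).coe_nnreal_ennreal

end Likelihood

end MixedSSM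

section ConditionalExpectation

variable {Ω S F : Type*} [MeasurableSpace Ω] [MeasurableSpace S] [MeasurableSpace F]
  {P : Measure Ω} [IsFiniteMeasure P] {U : Ω → S} {V : Ω → F} {κ : Kernel S F} [IsSFiniteKernel κ]

lemma condExp_comap_ae_eq_integral (hU : Measurable U) (h : HasCondDistrib V U κ P) {φ : F → ℝ}
    (hφ : Measurable φ) (hint : Integrable (fun ω => φ (V ω)) P) :
    P[fun ω => φ (V ω) | MeasurableSpace.comap U inferInstance]
      =ᵐ[P] fun ω => ∫ x, φ x ∂κ (U ω) := by
  have hφ₂ : Measurable fun p : S × F => φ p.2 := hφ.comp measurable_snd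
  have hmean : StronglyMeasurable fun s => ∫ x, φ x ∂κ s := hφ.stronglyMeasurable.integral_kernel
  have hint_compProd : Integrable (fun p : S × F => φ p.2) (P.map U ⊗ₘ κ) := by
    rw [← h.map_eq]
    exact (integrable_map_measure hφ₂.aestronglyMeasurable h.aemeasurable).2 hint
  have hint_mean : Integrable (fun s => ∫ x, φ x ∂κ s) (P.map U) :=
    ((Measure.integrable_compProd_iff hφ₂.aestronglyMeasurable).1 hint_compProd).2.mono'
      hmean.aestronglyMeasurable (ae_of_all _ fun s => norm_integral_le_integral_norm _)
  symm
  refine ae_eq_condExp_of_forall_setIntegral_eq hU.comap_le hint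
    (fun _ _ _ => (hint_mean.comp_measurable hU).integrableOn) ?_
    (hmean.comp_measurable (comap_measurable U)).aestronglyMeasurable
  rintro _ ⟨B, hB, rfl⟩ -
  have hprod : U ⁻¹' B = (fun ω => (U ω, V ω)) ⁻¹' (B ×ˢ Set.univ) := by
    ext ω
    simp
  rw [← setIntegral_map (f := fun s => ∫ x, φ x ∂κ s) hB hmean.aestronglyMeasurable
    hU.aemeasurable, hprod, ← setIntegral_map (f := fun p : S × F => φ p.2) (hB.prod .univ)
    hφ₂.aestronglyMeasurable h.aemeasurable, h.map_eq,
    Measure.setIntegral_compProd hB .univ hint_compProd.integrableOn]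
  simp only [setIntegral_univ]

end ConditionalExpectation

section ObsHistory

variable {m : ℕ → ℕ}

/-- The type of the values of the observations before time `t`. As an iterated product, it turns
the passage from time `t` to `t + 1` into the pairing with `Y_t`. -/
def ObsHistory (m : ℕ → ℕ) : ℕ → Type
  | 0 => Unit
  | t + 1 => ObsHistory m t × (Fin (m t) → ℝ)

instance ObsHistory.instMeasurableSpace (m : ℕ → ℕ) : ∀ t, MeasurableSpace (ObsHistory m t)
  | 0 => inferInstanceAs (MeasurableSpace Unit)
  | t + 1 =>
    have := ObsHistory.instMeasurableSpace m t
    inferInstanceAs (MeasurableSpace (ObsHistory m t × (Fin (m t) → ℝ)))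

/-- The part of the observation sequence `y` before time `t`. -/
def obsHistory (y : ∀ s, Fin (m s) → ℝ) : ∀ t, ObsHistory m t
  | 0 => ()
  | t + 1 => (obsHistory y t, y t)

lemma measurable_obsHistory {Ω : Type*} {mΩ : MeasurableSpace Ω} {Y : ∀ t, Ω → Fin (m t) → ℝ}
    {t : ℕ} (h : ∀ s < t, Measurable (Y s)) :
    Measurable fun ω => obsHistory (fun s => Y s ω) t := by
  induction t with
  | zero => exact measurable_const
  | succ t ih => exact (ih fun s hs => h s (by omega)).prodMk (h t (by omega))

lemma measurable_comap_obsHistory {Ω : Type*} (Y : ∀ t, Ω → Fin (m t) → ℝ) {s t : ℕ}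
    (hst : s < t) :
    Measurable[MeasurableSpace.comap (fun ω => obsHistory (fun s => Y s ω) t) inferInstance]
      (Y s) := by
  induction t with
  | zero => omega
  | succ t ih =>
    let S := ObsHistory m t × (Fin (m t) → ℝ)
    have hpair := comap_measurable (m := (inferInstance : MeasurableSpace S))
      fun ω => (obsHistory (fun s => Y s ω) t, Y t ω)
    rcases Nat.lt_succ_iff_lt_or_eq.1 hst with h | rfl
    · exact (ih h).mono hpair.fst.comap_le le_rfl
    · exact hpair.snd

lemma comap_obsHistory_succ {Ω : Type*} (Y : ∀ t, Ω → Fin (m t) → ℝ) (t : ℕ) :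
    MeasurableSpace.comap (fun ω => obsHistory (fun s => Y s ω) (t + 1)) inferInstance
      = obsSigma Y t := by
  refine le_antisymm (Measurable.comap_le (measurable_obsHistory fun s hs => ?_))
    (iSup₂_le fun s hs => (measurable_comap_obsHistory Y (by omega)).comap_le)
  exact (comap_measurable (Y s)).mono (le_iSup₂_of_le s (by omega) le_rfl) le_rfl

end ObsHistory

namespace MixedSSM

variable {E : ℕ → Type*} [∀ t, MeasurableSpace (E t)] {m : ℕ → ℕ} (M : MixedSSM E m)
  {A : ∀ t, Fin (m t) → Set ℝ}

/-- The predictive law of `X_t` on the data `y`, when all atoms of the observations lie in `A`. -/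
def pred (A : ∀ t, Fin (m t) → Set ℝ) (t : ℕ) (y : ∀ s, Fin (m s) → ℝ) : Measure (E t) :=
  predLaw M.init M.trans (fun s => M.lik A s (y s)) t

/-- The filtering law of `X_t` on the data `y`, when all atoms of the observations lie in `A`. -/
def filt (A : ∀ t, Fin (m t) → Set ℝ) (t : ℕ) (y : ∀ s, Fin (m s) → ℝ) : Measure (E t) :=
  bayesUpdate (M.pred A t y) (M.lik A t (y t))

/-- The Bayes update of the kernel `η` by the observation at time `t`, as a kernel in the parameter
of `η` and the observation. -/
def obsUpdate (hA : ∀ t i, (A t i).Countable) (t : ℕ) {S : Type*} [MeasurableSpace S]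
    (η : Kernel S (E t)) [IsFiniteKernel η] : Kernel (S × (Fin (m t) → ℝ)) (E t) :=
  bayesKernel (η.prodMkRight (Fin (m t) → ℝ)) (measurable_uncurry_snd S (M.measurable_lik hA t))

instance (hA : ∀ t i, (A t i).Countable) (t : ℕ) {S : Type*} [MeasurableSpace S]
    (η : Kernel S (E t)) [IsFiniteKernel η] : IsFiniteKernel (M.obsUpdate hA t η) := by
  unfold obsUpdate
  infer_instance

/-- The predictive law as a kernel in the past observations, bundled with its finiteness, on which
the construction of the next kernel depends. -/
def predKernel (hA : ∀ t i, (A t i).Countable) :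
    ∀ t, {η : Kernel (ObsHistory m t) (E t) // IsFiniteKernel η}
  | 0 => ⟨Kernel.const _ M.init, inferInstance⟩
  | t + 1 =>
    have : IsFiniteKernel (predKernel hA t).1 := (predKernel hA t).2
    let η : {η : Kernel (ObsHistory m t × (Fin (m t) → ℝ)) (E (t + 1)) // IsFiniteKernel η} :=
      ⟨M.trans t ∘ₖ M.obsUpdate hA t (predKernel hA t).1, inferInstance⟩
    η

instance (hA : ∀ t i, (A t i).Countable) (t : ℕ) : IsFiniteKernel (M.predKernel hA t).1 :=
  (M.predKernel hA t).2

lemma predKernel_obsHistory (hA : ∀ t i, (A t i).Countable) (t : ℕ) (y : ∀ s, Fin (m s) → ℝ) :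
    (M.predKernel hA t).1 (obsHistory y t) = M.pred A t y := by
  induction t with
  | zero => rfl
  | succ t ih => exact congrArg (fun μ => (bayesUpdate μ (M.lik A t (y t))).bind (M.trans t)) ih

lemma obsUpdate_predKernel_obsHistory (hA : ∀ t i, (A t i).Countable) (t : ℕ)
    (y : ∀ s, Fin (m s) → ℝ) :
    M.obsUpdate hA t (M.predKernel hA t).1 (obsHistory y t, y t) = M.filt A t y :=
  congrArg (bayesUpdate · (M.lik A t (y t))) (M.predKernel_obsHistory hA t y)

end MixedSSM

section Represents

variable {E : ℕ → Type*} [∀ t, MeasurableSpace (E t)] {m : ℕ → ℕ} {M : MixedSSM E m}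
  {A : ∀ t, Fin (m t) → Set ℝ} {T : ℕ} {Ω : Type*} {X : ∀ t, Ω → E t} {Y : ∀ t, Ω → Fin (m t) → ℝ}

/-- The `σ`-algebra generated by all states and all observed variables except `Y_{t,i}`, which
are the non-descendants of `Y_{t,i}`. -/
abbrev othersSigma (T : ℕ) (X : ∀ t, Ω → E t) (Y : ∀ t, Ω → Fin (m t) → ℝ) (t : ℕ)
    (i : Fin (m t)) : MeasurableSpace Ω :=
  (⨆ s, ⨆ (_ : s ≤ T), MeasurableSpace.comap (X s) inferInstance) ⊔
    ⨆ q : Σ s, Fin (m s), ⨆ (_ : q.1 ≤ T ∧ q ≠ ⟨t, i⟩),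
      MeasurableSpace.comap (fun ω => Y q.1 ω q.2) inferInstance

lemma measurable_othersSigma_state {s t : ℕ} (hs : s ≤ T) (i : Fin (m t)) :
    Measurable[othersSigma T X Y t i] (X s) :=
  (comap_measurable _).mono (le_sup_of_le_left (le_iSup₂_of_le s hs le_rfl)) le_rfl

lemma measurable_othersSigma_obs {t : ℕ} {i : Fin (m t)} (q : Σ s, Fin (m s)) (hq : q.1 ≤ T)
    (hne : q ≠ ⟨t, i⟩) : Measurable[othersSigma T X Y t i] fun ω => Y q.1 ω q.2 :=
  (comap_measurable _).mono (le_sup_of_le_right (le_iSup₂_of_le q ⟨hq, hne⟩ le_rfl)) le_rfl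

lemma measurable_othersSigma_obsHistory {t : ℕ} (ht : t ≤ T) (i : Fin (m t)) :
    Measurable[othersSigma T X Y t i] fun ω => obsHistory (fun s => Y s ω) t :=
  measurable_obsHistory fun s hs => @measurable_pi_lambda _ _ _ (othersSigma T X Y t i) _ _
    fun j => measurable_othersSigma_obs ⟨s, j⟩ (hs.le.trans ht)
      fun h => hs.ne (congrArg Sigma.fst h)

variable [MeasurableSpace Ω] {P : Measure Ω}

lemma MixedSSM.ae_piKernel_obs_eq_withDensity (hA : ∀ t i, (A t i).Countable) {t : ℕ}
    (hatoms : ∀ i, ∀ᵐ ω ∂P, ∀ y, y ∉ A t i → M.mass t i (X t ω) y = 0) :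
    ∀ᵐ ω ∂P, piKernel (M.obs t) (X t ω)
      = (Measure.pi fun i => atomRef (A t i)).withDensity fun y => M.lik A t y (X t ω) := by
  filter_upwards [ae_all_iff.2 hatoms] with ω hω
  exact M.piKernel_obs_eq_withDensity hA hω

namespace MixedSSM.Represents

lemma measurable_obsHistory (h : M.Represents T P X Y) {t : ℕ} (ht : t ≤ T + 1) :
    Measurable fun ω => obsHistory (fun s => Y s ω) t :=
  LPF.measurable_obsHistory fun s hs => h.measurable_Y s (by omega)

lemma othersSigma_le (h : M.Represents T P X Y) {t : ℕ} (i : Fin (m t)) :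
    othersSigma T X Y t i ≤ ‹MeasurableSpace Ω› :=
  sup_le (iSup₂_le fun s hs => (h.measurable_X s hs).comap_le)
    (iSup₂_le fun q hq => ((measurable_pi_apply q.2).comp (h.measurable_Y q.1 hq.1)).comap_le)

variable [IsProbabilityMeasure P]

lemma hasCondDistrib_obs (h : M.Represents T P X Y) {t : ℕ} (ht : t ≤ T) :
    HasCondDistrib (Y t) (fun ω => (obsHistory (fun s => Y s ω) t, X t ω))
      ((piKernel (M.obs t)).prodMkLeft (ObsHistory m t)) P :=
  hasCondDistrib_pi_of_condExp (m := othersSigma T X Y t) (V := fun i ω => Y t ω i)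
    (κ := fun i => (M.obs t i).prodMkLeft (ObsHistory m t)) h.othersSigma_le
    ((h.measurable_obsHistory (by omega)).prodMk (h.measurable_X t ht))
    (fun i => (measurable_othersSigma_obsHistory ht i).prodMk (measurable_othersSigma_state ht i))
    (fun i => (measurable_pi_apply i).comp (h.measurable_Y t ht))
    (fun i j hji => measurable_othersSigma_obs ⟨t, j⟩ ht (by simpa using hji))
    (fun i B hB => h.obs t ht i B hB)

lemma hasCondDistrib_trans (h : M.Represents T P X Y) {t : ℕ} (ht : t < T) :
    HasCondDistrib (X (t + 1)) (fun ω => ((obsHistory (fun s => Y s ω) t, Y t ω), X t ω))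
      ((M.trans t).prodMkLeft (ObsHistory m t × (Fin (m t) → ℝ))) P := by
  refine hasCondDistrib_of_condExp (iSup₂_le fun s hs => ?_)
    (.prodMk (.prodMk ?_ ?_) ?_)
    (h.measurable_X (t + 1) ht) (h.trans t ht)
  · exact sup_le (h.measurable_X s (by omega)).comap_le (h.measurable_Y s (by omega)).comap_le
  · exact LPF.measurable_obsHistory fun s hs => (comap_measurable (Y s)).mono
      (le_iSup₂_of_le s (by omega) le_sup_right) le_rfl
  · exact (comap_measurable (Y t)).mono (le_iSup₂_of_le t le_rfl le_sup_right) le_rfl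
  · exact (comap_measurable (X t)).mono (le_iSup₂_of_le t le_rfl le_sup_left) le_rfl

lemma map_state (h : M.Represents T P X Y) {t : ℕ} (ht : t ≤ T) :
    P.map (X t) = markovLaw M.init M.trans t := by
  induction t with
  | zero => exact h.init
  | succ t ih =>
    ext B hB
    have hmass := lintegral_of_hasCondDistrib (h.hasCondDistrib_trans ht)
      (f := fun p => B.indicator 1 p.2) ((measurable_one.indicator hB).comp measurable_snd)
    simp_rw [Kernel.prodMkLeft_apply, lintegral_indicator_one hB] at hmass
    rw [markovLaw, Measure.bind_apply hB (M.trans t).aemeasurable, ← ih (by omega),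
      lintegral_map ((M.trans t).measurable_coe hB) (h.measurable_X t (by omega)), ← hmass,
      ← lintegral_indicator_one hB,
      lintegral_map (measurable_one.indicator hB) (h.measurable_X (t + 1) ht)]

lemma hasCondDistrib_filt_of_pred (h : M.Represents T P X Y) (hA : ∀ t i, (A t i).Countable)
    {t : ℕ} (ht : t ≤ T) (hatoms : ∀ i, ∀ᵐ ω ∂P, ∀ y, y ∉ A t i → M.mass t i (X t ω) y = 0)
    (hpred : HasCondDistrib (X t) (fun ω => obsHistory (fun s => Y s ω) t)
      (M.predKernel hA t).1 P) :
    HasCondDistrib (X t) (fun ω => (obsHistory (fun s => Y s ω) t, Y t ω))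
      (M.obsUpdate hA t (M.predKernel hA t).1) P := by
  have (i : Fin (m t)) : SigmaFinite (atomRef (A t i)) := sigmaFinite_atomRef (hA t i)
  exact hasCondDistrib_bayesKernel (h.measurable_obsHistory (by omega)) (h.measurable_Y t ht)
    (h.measurable_X t ht) hpred (h.hasCondDistrib_obs ht) (M.measurable_lik hA t)
    (ae_piKernel_obs_eq_withDensity hA hatoms)

lemma hasCondDistrib_pred (h : M.Represents T P X Y) (hA : ∀ t i, (A t i).Countable)
    (hatoms : ∀ t ≤ T, ∀ i, ∀ᵐ ω ∂P, ∀ y, y ∉ A t i → M.mass t i (X t ω) y = 0) {t : ℕ}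
    (ht : t ≤ T) :
    HasCondDistrib (X t) (fun ω => obsHistory (fun s => Y s ω) t) (M.predKernel hA t).1 P := by
  induction t with
  | zero => exact hasCondDistrib_const ⟨(h.measurable_X 0 ht).aemeasurable, h.init⟩ ()
  | succ t ih =>
    have ht' : t ≤ T := Nat.le_of_lt ht
    have hlaw := hasCondDistrib_comp
      (h.hasCondDistrib_filt_of_pred hA ht' (hatoms t ht') (ih ht')) (h.hasCondDistrib_trans ht)
    exact hlaw

lemma hasCondDistrib_filt (h : M.Represents T P X Y) (hA : ∀ t i, (A t i).Countable)
    (hatoms : ∀ t ≤ T, ∀ i, ∀ᵐ ω ∂P, ∀ y, y ∉ A t i → M.mass t i (X t ω) y = 0) {t : ℕ}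
    (ht : t ≤ T) :
    HasCondDistrib (X t) (fun ω => (obsHistory (fun s => Y s ω) t, Y t ω))
      (M.obsUpdate hA t (M.predKernel hA t).1) P :=
  h.hasCondDistrib_filt_of_pred hA ht (hatoms t ht) (h.hasCondDistrib_pred hA hatoms ht)

lemma ae_lintegral_lik_pred_ne_zero (h : M.Represents T P X Y) (hA : ∀ t i, (A t i).Countable)
    (hatoms : ∀ t ≤ T, ∀ i, ∀ᵐ ω ∂P, ∀ y, y ∉ A t i → M.mass t i (X t ω) y = 0) {t : ℕ}
    (ht : t ≤ T) :
    ∀ᵐ ω ∂P, ∫⁻ x, M.lik A t (Y t ω) x ∂M.pred A t (fun s => Y s ω) ≠ 0 := by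
  have (i : Fin (m t)) : SigmaFinite (atomRef (A t i)) := sigmaFinite_atomRef (hA t i)
  filter_upwards [ae_normalizer_ne_zero_and_ne_top (h.hasCondDistrib_pred hA hatoms ht)
    (h.hasCondDistrib_obs ht) (M.measurable_lik hA t)
    (ae_piKernel_obs_eq_withDensity hA (hatoms t ht))] with ω hω
  rw [← M.predKernel_obsHistory hA]
  exact hω.1

lemma condExp_ae_eq_integral_filt (h : M.Represents T P X Y) (hA : ∀ t i, (A t i).Countable)
    (hatoms : ∀ t ≤ T, ∀ i, ∀ᵐ ω ∂P, ∀ y, y ∉ A t i → M.mass t i (X t ω) y = 0) {t : ℕ}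
    (ht : t ≤ T) {φ : E t → ℝ} (hφ : Measurable φ) (hint : Integrable (fun ω => φ (X t ω)) P) :
    P[fun ω => φ (X t ω) | obsSigma Y t]
      =ᵐ[P] fun ω => ∫ x, φ x ∂M.filt A t (fun s => Y s ω) := by
  have hmeas : Measurable fun ω => (obsHistory (fun s => Y s ω) t, Y t ω) :=
    (h.measurable_obsHistory (by omega)).prodMk (h.measurable_Y t ht)
  have hcond := condExp_comap_ae_eq_integral hmeas (h.hasCondDistrib_filt hA hatoms ht) hφ hint
  simp_rw [M.obsUpdate_predKernel_obsHistory hA] at hcond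
  rwa [← comap_obsHistory_succ]

end MixedSSM.Represents

end Represents

section LexWeight

lemma foldl_lexUpdate {ι : Type*} (F f : ι → ℝ≥0) (l : List ι) (p : ℕ × ℝ≥0) :
    l.foldl (fun p i => lexUpdate p (F i) (f i)) p
      = (p.1 + (l.map fun i => if 0 < F i then 0 else 1).sum,
          p.2 * (l.map fun i => if 0 < F i then F i else f i).prod) := by
  induction l generalizing p with
  | nil => simp
  | cons i l ih =>
    rw [List.foldl_cons, ih]
    by_cases h : 0 < F i <;> simp [lexUpdate, h, mul_assoc, add_assoc]

namespace MixedSSM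

variable {E : ℕ → Type*} [∀ t, MeasurableSpace (E t)] {m : ℕ → ℕ} (M : MixedSSM E m)

lemma lexWeight_eq (t : ℕ) (y : Fin (m t) → ℝ) (x : E t) :
    M.lexWeight t y x = (∑ i, if 0 < M.mass t i x (y i) then 0 else 1,
      ∏ i, if 0 < M.mass t i x (y i) then M.mass t i x (y i) else M.dens t i x (y i)) := by
  rw [lexWeight, foldl_lexUpdate (fun i => M.mass t i x (y i)) (fun i => M.dens t i x (y i)),
    zero_add, one_mul, Fin.sum_univ_def, Fin.prod_univ_def]

open Classical in
/-- The number of the observed values at time `t` that are not atoms in `A`, which are those whose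
factor in `M.lik A` is a density. -/
def numNonatoms (A : ∀ t, Fin (m t) → Set ℝ) (t : ℕ) (y : Fin (m t) → ℝ) : ℕ :=
  ∑ i, if y i ∈ A t i then 0 else 1

variable {A : ∀ t, Fin (m t) → Set ℝ} {M} {t : ℕ} {y : Fin (m t) → ℝ} {x : E t}

open Classical in
lemma ite_mem_atoms_le (hx : ∀ i, y i ∉ A t i → M.mass t i x (y i) = 0) (i : Fin (m t)) :
    (if y i ∈ A t i then 0 else 1) ≤ if 0 < M.mass t i x (y i) then 0 else 1 := by
  by_cases h : y i ∈ A t i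
  · simp [h]
  · simp [h, hx i h]

lemma numNonatoms_le_lexWeight (hx : ∀ i, y i ∉ A t i → M.mass t i x (y i) = 0) :
    numNonatoms A t y ≤ (M.lexWeight t y x).1 := by
  rw [lexWeight_eq]
  exact Finset.sum_le_sum fun i _ => ite_mem_atoms_le hx i

lemma lexWeight_snd_eq_lik (hx : ∀ i, y i ∉ A t i → M.mass t i x (y i) = 0)
    (h : (M.lexWeight t y x).1 = numNonatoms A t y) : (M.lexWeight t y x).2 = M.lik A t y x := by
  classical
  rw [lexWeight_eq] at h ⊢
  have hcoord := (Finset.sum_eq_sum_iff_of_le (s := Finset.univ)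
    fun i _ => ite_mem_atoms_le hx i).1 h.symm
  simp only [lik]
  refine Finset.prod_congr rfl fun i hi => ?_
  by_cases hy : y i ∈ A t i
  · have hpos : 0 < M.mass t i x (y i) := by
      simpa [hy, pos_iff_ne_zero] using hcoord i hi
    simp [coordLik, hy, hpos]
  · simp [coordLik, hy, hx i hy]

lemma lik_eq_zero_of_lexWeight_fst_ne (hx : ∀ i, y i ∉ A t i → M.mass t i x (y i) = 0)
    (h : (M.lexWeight t y x).1 ≠ numNonatoms A t y) : M.lik A t y x = 0 := by
  classical
  have hlt := (numNonatoms_le_lexWeight hx).lt_of_ne' h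
  rw [lexWeight_eq] at hlt
  obtain ⟨i, hi, hlt⟩ := Finset.exists_lt_of_sum_lt hlt
  refine Finset.prod_eq_zero hi ?_
  by_cases hy : y i ∈ A t i
  · have hzero : ¬ 0 < M.mass t i x (y i) := fun hpos => by simp [hy, hpos] at hlt
    simpa [coordLik, hy] using hzero
  · simp [hy, hx i hy] at hlt

variable {K : ℕ} {x : Fin K → E t}

lemma dStar_eq_numNonatoms (hx : ∀ k i, y i ∉ A t i → M.mass t i (x k) (y i) = 0)
    (hpos : ∃ k, M.lik A t y (x k) ≠ 0) : M.dStar t y x = numNonatoms A t y := by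
  obtain ⟨k, hk⟩ := hpos
  have hd : (M.lexWeight t y (x k)).1 = numNonatoms A t y :=
    not_imp_comm.1 (lik_eq_zero_of_lexWeight_fst_ne (hx k)) hk
  have hmem : numNonatoms A t y
      ∈ {d | ∃ k, (M.lexWeight t y (x k)).2 ≠ 0 ∧ (M.lexWeight t y (x k)).1 = d} :=
    ⟨k, by rwa [lexWeight_snd_eq_lik (hx k) hd], hd⟩
  refine le_antisymm (Nat.sInf_le hmem) (le_csInf ⟨_, hmem⟩ ?_)
  rintro d ⟨j, -, rfl⟩
  exact numNonatoms_le_lexWeight (hx j)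

lemma keptWeight_eq_lik (hx : ∀ k i, y i ∉ A t i → M.mass t i (x k) (y i) = 0)
    (hpos : ∃ k, M.lik A t y (x k) ≠ 0) (k : Fin K) :
    M.keptWeight t y x k = M.lik A t y (x k) := by
  rw [keptWeight, dStar_eq_numNonatoms hx hpos]
  split_ifs with h
  · rw [lik_eq_zero_of_lexWeight_fst_ne (hx k) h.ne', NNReal.coe_zero]
  · rw [lexWeight_snd_eq_lik (hx k) (le_antisymm (not_lt.1 h) (numNonatoms_le_lexWeight (hx k)))]

end MixedSSM

end LexWeight

section Mixture

variable {ι F : Type*} [Fintype ι] [MeasurableSpace F]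

/-- The mixture of the measures `μ j` with probabilities proportional to the weights `w j`. It is
the junk value `0` if all weights vanish. -/
def mixture (w : ι → ℝ≥0) (μ : ι → Measure F) : Measure F :=
  ∑ j, (w j / ∑ l, w l) • μ j

variable {w : ι → ℝ≥0} {μ : ι → Measure F}

lemma isProbabilityMeasure_mixture [∀ j, IsProbabilityMeasure (μ j)] (hw : ∃ j, w j ≠ 0) :
    IsProbabilityMeasure (mixture w μ) := by
  have hsum : ∑ l, w l ≠ 0 := by simpa [Finset.sum_eq_zero_iff] using hw
  constructor
  simp only [mixture, Measure.coe_finsetSum, Finset.sum_apply, Measure.smul_apply, measure_univ]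
  simp only [ENNReal.smul_def, smul_eq_mul, mul_one]
  rw [← ENNReal.ofNNReal_finsetSum, ← Finset.sum_div, div_self hsum, ENNReal.coe_one]

lemma pi_mixture {κ : Type*} [Fintype κ] [DecidableEq κ] [∀ j, IsProbabilityMeasure (μ j)] :
    Measure.pi (fun _ : κ => mixture w μ)
      = ∑ j : κ → ι, (∏ k, w (j k) / ∑ l, w l) • Measure.pi fun k => μ (j k) := by
  have : IsFiniteMeasure (mixture w μ) := by unfold mixture; infer_instance
  refine Measure.pi_eq fun B _ => ?_
  simp only [mixture, Measure.coe_finsetSum, Finset.sum_apply, Measure.smul_apply, Measure.pi_pi]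
  simp only [ENNReal.smul_def, smul_eq_mul, ENNReal.ofNNReal_finsetProd]
  rw [Finset.prod_univ_sum, Fintype.piFinset_univ]
  simp_rw [Finset.prod_mul_distrib]

lemma lintegral_mixture_le {φ : F → ℝ≥0∞} {R : ℝ≥0}
    (hR : ∑ j, w j * ∫⁻ z, φ z ∂μ j ≤ R * ∑ j, (w j : ℝ≥0∞)) :
    ∫⁻ z, φ z ∂mixture w μ ≤ R := by
  rw [mixture, lintegral_finsetSum_measure]
  rcases eq_or_ne (∑ l, w l) 0 with hw | hw
  · simp [hw]
  · simp_rw [lintegral_smul_measure, ENNReal.smul_def, ENNReal.coe_div hw, smul_eq_mul,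
      ← ENNReal.mul_div_right_comm, div_eq_mul_inv, ← Finset.sum_mul, ← div_eq_mul_inv]
    exact ENNReal.div_le_of_le_mul (by rwa [ENNReal.ofNNReal_finsetSum])

lemma integral_mixture {φ : F → ℝ} (hφ : Integrable φ (mixture w μ)) :
    ∫ z, φ z ∂mixture w μ = (∑ j, w j * ∫ z, φ z ∂μ j) / ∑ j, (w j : ℝ) := by
  have hφj := integrable_finsetSum_measure.1 hφ
  rw [mixture, integral_finsetSum_measure hφj, Finset.sum_div]
  simp_rw [integral_smul_nnreal_measure, NNReal.smul_def, NNReal.coe_div, NNReal.coe_sum,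
    smul_eq_mul, div_mul_eq_mul_div]

end Mixture

section ConditionalIndex

variable {Ω S F ι : Type*} {m m₀ : MeasurableSpace Ω} [MeasurableSpace S] [MeasurableSpace F]
  {P : Measure Ω} {U : Ω → S}

lemma setLIntegral_inter_eq_of_condExp [IsFiniteMeasure P] (hm : m ≤ m₀) (hU : Measurable[m] U)
    {V : Set Ω} (hV : MeasurableSet V) {N : Set S} (hN : MeasurableSet N) {p : S → ℝ}
    (hp : Measurable p)
    (h : ∀ᵐ ω ∂P, U ω ∈ N → (P[V.indicator fun _ => (1 : ℝ) | m]) ω = p (U ω))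
    {q : S → ℝ≥0∞} (hq : Measurable q) :
    ∫⁻ ω in U ⁻¹' N ∩ V, q (U ω) ∂P = ∫⁻ ω in U ⁻¹' N, ENNReal.ofReal (p (U ω)) * q (U ω) ∂P := by
  have hU' : Measurable U := hU.mono hm le_rfl
  have hmap : (P.restrict (U ⁻¹' N ∩ V)).map U
      = ((P.restrict (U ⁻¹' N)).map U).withDensity fun s => ENNReal.ofReal (p s) := by
    ext B hB
    rw [withDensity_apply _ hB, setLIntegral_map hB hp.ennreal_ofReal hU',
      Measure.restrict_restrict (hU' hB), Measure.map_apply hU' hB,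
      Measure.restrict_apply (hU' hB), ← Set.inter_assoc]
    exact measure_inter_eq_setLIntegral_of_condExp hm hV ((hU hB).inter (hU hN))
      (h.mono fun ω hω hmem => hω hmem.2)
  rw [← lintegral_map hq hU', hmap, lintegral_withDensity_eq_lintegral_mul _ hp.ennreal_ofReal hq,
    lintegral_map (hp.ennreal_ofReal.mul hq) hU']
  rfl

variable [MeasurableSpace ι] [MeasurableSingletonClass ι] {V : Ω → F} {J : Ω → ι}
  {κ : Kernel (S × ι) F} [IsSFiniteKernel κ]

lemma measure_inter_preimage_singleton_eq [SFinite P] (hU : Measurable U) (hJ : Measurable J)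
    (hV : HasCondDistrib V (fun ω => (U ω, J ω)) κ P) {D : Set (S × F)} (hD : MeasurableSet D)
    {N : Set S} (hN : MeasurableSet N) (j : ι) :
    P ({ω | U ω ∈ N ∧ (U ω, V ω) ∈ D} ∩ J ⁻¹' {j})
      = ∫⁻ ω in U ⁻¹' N ∩ J ⁻¹' {j}, κ (U ω, j) (Prod.mk (U ω) ⁻¹' D) ∂P := by
  set R : Set ((S × ι) × F) := (N ×ˢ {j}) ×ˢ Set.univ ∩ (fun p => (p.1.1, p.2)) ⁻¹' D
  have hNj : MeasurableSet (N ×ˢ ({j} : Set ι)) := hN.prod (measurableSet_singleton j)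
  have hR : MeasurableSet R := (hNj.prod .univ).inter
    ((by fun_prop : Measurable fun p : (S × ι) × F => (p.1.1, p.2)) hD)
  have hslice (p : S × ι) : κ p (Prod.mk p ⁻¹' R)
      = (N ×ˢ {j}).indicator (fun p => κ (p.1, j) (Prod.mk p.1 ⁻¹' D)) p := by
    by_cases hp : p ∈ N ×ˢ ({j} : Set ι)
    · have hpj : p = (p.1, j) := Prod.ext rfl hp.2
      rw [Set.indicator_of_mem hp, ← hpj]
      congr 1
      ext v
      simp [R, hp.1, hp.2]
    · have hempty : Prod.mk p ⁻¹' R = ∅ := Set.eq_empty_of_forall_notMem fun v hv => hp hv.1.1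
      rw [Set.indicator_of_notMem hp, hempty, measure_empty]
  calc P ({ω | U ω ∈ N ∧ (U ω, V ω) ∈ D} ∩ J ⁻¹' {j})
    _ = P.map (fun ω => ((U ω, J ω), V ω)) R := by
      rw [Measure.map_apply_of_aemeasurable hV.aemeasurable hR]
      congr 1
      ext ω
      simp only [R, Set.mem_inter_iff, Set.mem_ofPred_eq, Set.mem_preimage, Set.mem_prod,
        Set.mem_univ, Set.mem_singleton_iff]
      tauto
    _ = ∫⁻ ω, κ (U ω, J ω) (Prod.mk (U ω, J ω) ⁻¹' R) ∂P := by
      rw [hV.map_eq, Measure.compProd_apply hR,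
        lintegral_map (Kernel.measurable_kernel_prodMk_left hR) (hU.prodMk hJ)]
    _ = _ := by
      simp_rw [hslice]
      rw [← lintegral_indicator ((hU hN).inter (hJ (measurableSet_singleton j)))]
      rfl

lemma measure_le_of_condExp_of_hasCondDistrib [Fintype ι] [IsProbabilityMeasure P] (hm : m ≤ m₀)
    (hU : Measurable[m] U) (hJ : Measurable J)
    (hV : HasCondDistrib V (fun ω => (U ω, J ω)) κ P) {N : Set S} (hN : MeasurableSet N)
    {p : ι → S → ℝ} (hp : ∀ j, Measurable (p j))
    (h : ∀ j, ∀ᵐ ω ∂P, U ω ∈ N →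
      (P[(J ⁻¹' {j}).indicator fun _ => (1 : ℝ) | m]) ω = p j (U ω))
    {D : Set (S × F)} (hD : MeasurableSet D) {c : ℝ≥0∞}
    (hc : ∀ x ∈ N, ∑ j, ENNReal.ofReal (p j x) * κ (x, j) (Prod.mk x ⁻¹' D) ≤ c) :
    P {ω | U ω ∈ N ∧ (U ω, V ω) ∈ D} ≤ c := by
  have hU' : Measurable U := hU.mono hm le_rfl
  have hq (j : ι) : Measurable fun x => κ (x, j) (Prod.mk x ⁻¹' D) :=
    Kernel.measurable_kernel_prodMk_left
      (κ := κ.comap (fun x => (x, j)) measurable_prodMk_right) hD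
  calc P {ω | U ω ∈ N ∧ (U ω, V ω) ∈ D}
      ≤ ∑ j, P ({ω | U ω ∈ N ∧ (U ω, V ω) ∈ D} ∩ J ⁻¹' {j}) := by
        refine (measure_mono fun ω hω => ?_).trans (measure_iUnion_fintype_le P _)
        exact Set.mem_iUnion.2 ⟨J ω, hω, rfl⟩
    _ = ∑ j, ∫⁻ ω in U ⁻¹' N,
          ENNReal.ofReal (p j (U ω)) * κ (U ω, j) (Prod.mk (U ω) ⁻¹' D) ∂P :=
        Finset.sum_congr rfl fun j _ => by
          rw [measure_inter_preimage_singleton_eq hU' hJ hV hD hN,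
            setLIntegral_inter_eq_of_condExp hm hU (hJ (measurableSet_singleton j)) hN (hp j) (h j)
              (hq j)]
    _ = ∫⁻ ω in U ⁻¹' N,
          ∑ j, ENNReal.ofReal (p j (U ω)) * κ (U ω, j) (Prod.mk (U ω) ⁻¹' D) ∂P :=
        (lintegral_finsetSum _ fun j _ =>
          ((hp j).ennreal_ofReal.mul (hq j)).comp hU').symm
    _ ≤ ∫⁻ _ in U ⁻¹' N, c ∂P := setLIntegral_mono' (hU' hN) fun ω hω => hc (U ω) hω
    _ ≤ c := by
        rw [setLIntegral_const]
        exact mul_le_of_le_one_right' prob_le_one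

end ConditionalIndex

namespace MixedSSM

section Propagate

variable {E : ℕ → Type*} [∀ t, MeasurableSpace (E t)] {m : ℕ → ℕ} (M : MixedSSM E m)

lemma measurable_resampled (t K : ℕ) (k : Fin K) :
    Measurable fun p : (Fin K → E t) × (Fin K → Fin K) => p.1 (p.2 k) :=
  measurable_from_prod_countable_left fun j => measurable_pi_apply (j k)

/-- The conditional law of the `K` particles at time `t + 1` given the particles and the resampling
indices at time `t`. -/
def propagateKernel (t K : ℕ) :
    Kernel ((Fin K → E t) × (Fin K → Fin K)) (Fin K → E (t + 1)) :=
  piKernel fun k => (M.trans t).comap (fun p => p.1 (p.2 k)) (measurable_resampled t K k)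

instance (t K : ℕ) : IsMarkovKernel (M.propagateKernel t K) :=
  inferInstanceAs (IsMarkovKernel (piKernel _))

lemma propagateKernel_apply {t K : ℕ} (p : (Fin K → E t) × (Fin K → Fin K)) :
    M.propagateKernel t K p = Measure.pi fun k => M.trans t (p.1 (p.2 k)) := rfl

lemma sum_propagateKernel_eq_pi_mixture (w : E t → ℝ≥0) (x : Fin K → E t)
    (B : Set (Fin K → E (t + 1))) :
    ∑ j : Fin K → Fin K, ENNReal.ofReal (∏ k, ((w (x (j k)) : ℝ) / ∑ l, (w (x l) : ℝ)))
        * M.propagateKernel t K (x, j) B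
      = Measure.pi (fun _ : Fin K => mixture (fun k => w (x k)) fun k => M.trans t (x k)) B := by
  rw [pi_mixture, Measure.coe_finsetSum, Finset.sum_apply]
  refine Finset.sum_congr rfl fun j _ => ?_
  rw [propagateKernel_apply, Measure.smul_apply, ENNReal.smul_def, smul_eq_mul,
    ← ENNReal.ofReal_coe_nnreal]
  push_cast
  rfl

end Propagate

namespace IsRun

variable {E : ℕ → Type*} [∀ t, MeasurableSpace (E t)] {m : ℕ → ℕ} {M : MixedSSM E m}
  {T : ℕ} {y : ∀ t, Fin (m t) → ℝ} {K : ℕ} {Ω' : Type*} [MeasurableSpace Ω'] {ν : Measure Ω'}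
  {ξ : ∀ t, Ω' → Fin K → E t} {α : ℕ → Ω' → Fin K → Fin K} {t : ℕ}

lemma measurable_particle_apply (h : M.IsRun T y K ν ξ α) (ht : t ≤ T) (k : Fin K) :
    Measurable fun ω => ξ t ω k :=
  (measurable_pi_apply k).comp (h.measurable_particle t ht)

lemma measure_init_error_ge_le (h : M.IsRun T y K ν ξ α) (hK : 0 < K) {φ : E 0 → ℝ}
    (hφ : Measurable φ) {R : ℝ≥0} (hR : ∫⁻ x, ‖φ x‖ₑ ^ 4 ∂M.init ≤ R) {ε : ℝ} (hε : 0 < ε) :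
    ν {ω | ε ≤ |(∑ k, φ (ξ 0 ω k)) / K - ∫ x, φ x ∂M.init|}
      ≤ ENNReal.ofReal (48 * R / ε ^ 4 / K ^ 2) := by
  have hle := measure_empirical_error_ge_le hφ hR hε hK
  rw [← h.init, Measure.map_apply (h.measurable_particle 0 T.zero_le)
    (measurableSet_le measurable_const (by fun_prop))] at hle
  exact hle

variable [IsProbabilityMeasure ν]

lemma hasCondDistrib_propagate (h : M.IsRun T y K ν ξ α) (ht : t < T) :
    HasCondDistrib (ξ (t + 1)) (fun ω => (ξ t ω, α t ω)) (M.propagateKernel t K) ν := by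
  refine hasCondDistrib_of_condExp (iSup₂_le fun s hs => sup_le
    (h.measurable_particle s (by omega)).comap_le (h.measurable_index s (by omega)).comap_le)
    (.prodMk ?_ ?_) (h.measurable_particle (t + 1) ht) (h.propagate t ht)
  · exact (comap_measurable (ξ t)).mono (le_iSup₂_of_le t le_rfl le_sup_left) le_rfl
  · exact (comap_measurable (α t)).mono (le_iSup₂_of_le t le_rfl le_sup_right) le_rfl

lemma measure_succ_particle_le (h : M.IsRun T y K ν ξ α) (ht : t < T) {w : E t → ℝ≥0}
    (hwm : Measurable w)
    (hw : ∀ᵐ ω ∂ν, (∃ k, w (ξ t ω k) ≠ 0) → ∀ k, M.keptWeight t (y t) (ξ t ω) k = w (ξ t ω k))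
    {D : Set ((Fin K → E t) × (Fin K → E (t + 1)))} (hD : MeasurableSet D) {c : ℝ≥0∞}
    (hc : ∀ x : Fin K → E t, (∃ k, w (x k) ≠ 0) →
      Measure.pi (fun _ : Fin K => mixture (fun k => w (x k)) fun k => M.trans t (x k))
        (Prod.mk x ⁻¹' D) ≤ c) :
    ν {ω | (∃ k, w (ξ t ω k) ≠ 0) ∧ (ξ t ω, ξ (t + 1) ω) ∈ D} ≤ c := by
  have hpast : (⨆ s, ⨆ (_ : s ≤ t), MeasurableSpace.comap (ξ s) inferInstance) ⊔
      (⨆ s, ⨆ (_ : s < t), MeasurableSpace.comap (α s) inferInstance) ≤ ‹MeasurableSpace Ω'› :=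
    sup_le (iSup₂_le fun s hs => (h.measurable_particle s (by omega)).comap_le)
      (iSup₂_le fun s hs => (h.measurable_index s (by omega)).comap_le)
  have hwk (k : Fin K) : Measurable fun x : Fin K → E t => w (x k) :=
    hwm.comp (measurable_pi_apply k)
  have hN : MeasurableSet {x : Fin K → E t | ∃ k, w (x k) ≠ 0} := by
    rw [Set.ofPred_exists]
    exact .iUnion fun k => (hwk k (measurableSet_singleton 0)).compl
  refine measure_le_of_condExp_of_hasCondDistrib
    (p := fun j x => ∏ k, ((w (x (j k)) : ℝ) / ∑ l, (w (x l) : ℝ))) hpast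
    ((comap_measurable _).mono (le_sup_of_le_left (le_iSup₂_of_le t le_rfl le_rfl)) le_rfl)
    (h.measurable_index t ht) (h.hasCondDistrib_propagate ht) hN (by fun_prop) (fun j => ?_) hD
    fun x hx => (M.sum_propagateKernel_eq_pi_mixture w x _).trans_le (hc x hx)
  filter_upwards [hw, h.resample t ht j] with ω hkept hresample hpos
  simp only [hkept hpos] at hresample
  refine hresample ?_
  have hsum : ∑ l, w (ξ t ω l) ≠ 0 := by simpa [Finset.sum_eq_zero_iff] using hpos
  exact_mod_cast hsum

lemma measure_succ_error_ge_le (h : M.IsRun T y K ν ξ α) (hK : 0 < K) (ht : t < T)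
    {w : E t → ℝ≥0} (hwm : Measurable w)
    (hw : ∀ᵐ ω ∂ν, (∃ k, w (ξ t ω k) ≠ 0) → ∀ k, M.keptWeight t (y t) (ξ t ω) k = w (ξ t ω k))
    {φ : E (t + 1) → ℝ} (hφ : Measurable φ) (R : ℝ≥0) {ε : ℝ} (hε : 0 < ε) :
    ν {ω | ((∃ k, w (ξ t ω k) ≠ 0) ∧ ∑ k, w (ξ t ω k) * ∫⁻ z, ‖φ z‖ₑ ^ 4 ∂M.trans t (ξ t ω k)
          ≤ R * ∑ k, (w (ξ t ω k) : ℝ≥0∞)) ∧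
        ε ≤ |(∑ k, φ (ξ (t + 1) ω k)) / K -
          (∑ k, w (ξ t ω k) * ∫ z, φ z ∂M.trans t (ξ t ω k)) / ∑ k, (w (ξ t ω k) : ℝ)|}
      ≤ ENNReal.ofReal (48 * R / ε ^ 4 / K ^ 2) := by
  have hψ (k : Fin K) : Measurable fun p : (Fin K → E t) × (Fin K → E (t + 1)) =>
      ∫ z, φ z ∂M.trans t (p.1 k) :=
    (measurable_integral_kernel _ hφ).comp (measurable_pi_apply k |>.comp measurable_fst)
  have : Measurable fun x => ∫⁻ z, ‖φ z‖ₑ ^ 4 ∂M.trans t x :=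
    Measurable.lintegral_kernel (by fun_prop)
  have hD : MeasurableSet ({p : (Fin K → E t) × (Fin K → E (t + 1)) |
      ∑ k, w (p.1 k) * ∫⁻ z, ‖φ z‖ₑ ^ 4 ∂M.trans t (p.1 k) ≤ R * ∑ k, (w (p.1 k) : ℝ≥0∞)} ∩
      {p | ε ≤ |(∑ k, φ (p.2 k)) / K -
        (∑ k, w (p.1 k) * ∫ z, φ z ∂M.trans t (p.1 k)) / ∑ k, (w (p.1 k) : ℝ)|}) :=
    (measurableSet_le (by fun_prop) (by fun_prop)).inter
      (measurableSet_le measurable_const (by fun_prop))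
  simp_rw [and_assoc]
  refine h.measure_succ_particle_le ht hwm hw hD fun x hx => ?_
  by_cases hR : ∑ k, w (x k) * ∫⁻ z, ‖φ z‖ₑ ^ 4 ∂M.trans t (x k) ≤ R * ∑ k, (w (x k) : ℝ≥0∞)
  · have := isProbabilityMeasure_mixture (μ := fun k => M.trans t (x k)) hx
    have hφR := lintegral_mixture_le (w := fun k => w (x k)) (μ := fun k => M.trans t (x k)) hR
    have hint : Integrable φ (mixture (fun k => w (x k)) fun k => M.trans t (x k)) :=
      ((memLp_natCast_iff hφ four_ne_zero).2 (hφR.trans_lt ENNReal.coe_lt_top)).integrable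
        (by norm_num)
    simpa [hR, integral_mixture hint] using measure_empirical_error_ge_le hφ hφR hε hK
  · simp [hR]

lemma hasCondDistrib_particle_succ (h : M.IsRun T y K ν ξ α) (ht : t < T) (k : Fin K) :
    HasCondDistrib (fun ω => ξ (t + 1) ω k) (fun ω => ξ t ω (α t ω k)) (M.trans t) ν := by
  have hk : Measurable fun z : Fin K → E (t + 1) => z k := measurable_pi_apply k
  have heval : (M.propagateKernel t K).map (fun z => z k)
      = (M.trans t).comap (fun p => p.1 (p.2 k)) (measurable_resampled t K k) := by
    ext1 p
    rw [Kernel.map_apply _ hk, propagateKernel_apply, Kernel.comap_apply]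
    exact (measurePreserving_eval _ k).map_eq
  have hlaw := (h.hasCondDistrib_propagate ht).comp_left hk
  rw [heval] at hlaw
  exact hlaw.comp_right

lemma map_particle_absolutelyContinuous (h : M.IsRun T y K ν ξ α) (ht : t ≤ T) (k : Fin K) :
    ν.map (fun ω => ξ t ω k) ≪ markovLaw M.init M.trans t := by
  induction t generalizing k with
  | zero =>
    have heval := (measurePreserving_eval (fun _ : Fin K => M.init) k).map_eq
    rw [← h.init, Measure.map_map (measurable_pi_apply k) (h.measurable_particle 0 ht)] at heval
    exact heval.absolutelyContinuous
  | succ t ih =>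
    have hξ := h.measurable_particle t (by omega)
    have hα := h.measurable_index t ht
    have hres : Measurable fun ω => ξ t ω (α t ω k) :=
      (measurable_resampled t K k).comp (hξ.prodMk hα)
    have hresac : ν.map (fun ω => ξ t ω (α t ω k)) ≪ markovLaw M.init M.trans t := by
      refine Measure.AbsolutelyContinuous.mk fun N hN hN0 => ?_
      have hj (j : Fin K) : ν ((fun ω => ξ t ω j) ⁻¹' N) = 0 := by
        rw [← Measure.map_apply (h.measurable_particle_apply (by omega) j) hN]
        exact ih (by omega) j hN0
      rw [Measure.map_apply hres hN]
      exact measure_mono_null (fun ω hω => Set.mem_iUnion.2 ⟨α t ω k, hω⟩)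
        (measure_iUnion_null hj)
    have hmap : ν.map (fun ω => ξ (t + 1) ω k)
        = M.trans t ∘ₘ ν.map (fun ω => ξ t ω (α t ω k)) := by
      have hlaw := h.hasCondDistrib_particle_succ ht k
      rw [← Measure.snd_compProd, ← hlaw.map_eq, Measure.snd_map_prodMk hres]
    rw [hmap]
    exact hresac.comp_right _

lemma ae_forall_particle (h : M.IsRun T y K ν ξ α) (ht : t ≤ T) {p : E t → Prop}
    (hp : ∀ᵐ x ∂markovLaw M.init M.trans t, p x) : ∀ᵐ ω ∂ν, ∀ k, p (ξ t ω k) :=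
  ae_all_iff.2 fun k => ae_of_ae_map
    (h.measurable_particle_apply ht k).aemeasurable
    (h.map_particle_absolutelyContinuous ht k hp)

end IsRun

end MixedSSM

section RegularData

variable {E : ℕ → Type*} [∀ t, MeasurableSpace (E t)] {m : ℕ → ℕ} {M : MixedSSM E m}
  {A : ∀ t, Fin (m t) → Set ℝ} {t : ℕ}

lemma ae_allMoments_coordLik {B : Set ℝ} (hB : B.Countable) {i : Fin (m t)} {μ : Measure (E t)}
    [IsFiniteMeasure μ] (hdens : ∀ᵐ y : ℝ, AllMoments (fun x => (M.dens t i x y : ℝ)) μ) :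
    ∀ᵐ y ∂atomRef B, AllMoments (fun x => (M.coordLik B t i y x : ℝ)) μ := by
  have : Countable B := hB
  rw [atomRef, ae_add_measure_iff, Measure.ae_sum_iff]
  refine ⟨fun a => ?_, ?_⟩
  · rw [ae_dirac_eq]
    refine fun p => MemLp.of_bound ((M.measurable_coordLik hB t i).comp
      measurable_prodMk_left).coe_nnreal_real.aestronglyMeasurable 1 (ae_of_all _ fun x => ?_)
    simpa [MixedSSM.coordLik] using M.mass_le_one t i x a
  · filter_upwards [hdens, measure_eq_zero_iff_ae_notMem.1 (hB.measure_zero volume)] with y hy hyB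
    simpa only [MixedSSM.coordLik, hyB, if_false] using hy

lemma ae_allMoments_lik (hA : ∀ t i, (A t i).Countable) {μ : Measure (E t)} [IsFiniteMeasure μ]
    (hdens : ∀ i, ∀ᵐ y : ℝ, AllMoments (fun x => (M.dens t i x y : ℝ)) μ) :
    ∀ᵐ y ∂Measure.pi fun i => atomRef (A t i), AllMoments (fun x => (M.lik A t y x : ℝ)) μ := by
  have (i : Fin (m t)) : SigmaFinite (atomRef (A t i)) := sigmaFinite_atomRef (hA t i)
  have hcoord : ∀ᵐ y ∂Measure.pi fun i => atomRef (A t i),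
      ∀ i, AllMoments (fun x => (M.coordLik (A t i) t i (y i) x : ℝ)) μ :=
    ae_all_iff.2 fun i => (Measure.tendsto_eval_ae_ae (μ := fun i => atomRef (A t i))).eventually
      (ae_allMoments_coordLik (hA t i) (hdens i))
  filter_upwards [hcoord] with y hy
  simp only [MixedSSM.lik, NNReal.coe_prod]
  exact AllMoments.finset_prod _ fun i _ => hy i

namespace MixedSSM

variable {T : ℕ}

/-- The properties of the data `y_0, …, y_T` that make the filter consistent: the data are possible
under the predictive laws, the likelihoods have finite moments, and a data point outside the set of
atoms almost surely carries no point mass. -/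
structure IsRegularData (M : MixedSSM E m) (A : ∀ t, Fin (m t) → Set ℝ) (T : ℕ)
    (y : ∀ t, Fin (m t) → ℝ) : Prop where
  lintegral_lik_pred_ne_zero : ∀ t ≤ T, ∫⁻ x, M.lik A t (y t) x ∂M.pred A t y ≠ 0
  allMoments_lik : ∀ t ≤ T,
    AllMoments (fun x => (M.lik A t (y t) x : ℝ)) (markovLaw M.init M.trans t)
  ae_mass_eq_zero : ∀ t ≤ T, ∀ i, y t i ∉ A t i →
    ∀ᵐ x ∂markovLaw M.init M.trans t, M.mass t i x (y t i) = 0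

namespace Represents

variable {Ω : Type*} [MeasurableSpace Ω] {P : Measure Ω} [IsProbabilityMeasure P]
  {X : ∀ t, Ω → E t} {Y : ∀ t, Ω → Fin (m t) → ℝ}

lemma map_obs_absolutelyContinuous (h : M.Represents T P X Y) (hA : ∀ t i, (A t i).Countable)
    (hatoms : ∀ i, ∀ᵐ ω ∂P, ∀ y, y ∉ A t i → M.mass t i (X t ω) y = 0) (ht : t ≤ T) :
    P.map (Y t) ≪ Measure.pi fun i => atomRef (A t i) := by
  have hY := h.measurable_Y t ht
  refine Measure.AbsolutelyContinuous.mk fun N hN hN0 => ?_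
  have hlaw := lintegral_of_hasCondDistrib (h.hasCondDistrib_obs ht)
    (f := fun p => N.indicator 1 p.2) ((measurable_one.indicator hN).comp measurable_snd)
  simp_rw [Kernel.prodMkLeft_apply, lintegral_indicator_one hN] at hlaw
  rw [← lintegral_indicator_one hN, lintegral_map (measurable_one.indicator hN) hY, hlaw]
  refine lintegral_eq_zero_of_ae_eq_zero ?_
  filter_upwards [ae_piKernel_obs_eq_withDensity hA hatoms] with ω hω
  rw [hω]
  exact withDensity_absolutelyContinuous _ _ hN0

lemma allMoments_map_state {φ : E t → ℝ} (h : M.Represents T P X Y) (ht : t ≤ T)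
    (hφ : Measurable φ) (hφX : ∀ p : ℕ, MemLp (fun ω => φ (X t ω)) p P) :
    AllMoments φ (markovLaw M.init M.trans t) := fun p => by
  rw [← h.map_state ht]
  exact (memLp_map_measure_iff hφ.aestronglyMeasurable (h.measurable_X t ht).aemeasurable).2
    (hφX p)

lemma ae_isRegularData (h : M.Represents T P X Y) (hA : ∀ t i, (A t i).Countable)
    (hatoms : ∀ t ≤ T, ∀ i, ∀ᵐ ω ∂P, ∀ y, y ∉ A t i → M.mass t i (X t ω) y = 0)
    (hdens : ∀ t ≤ T, ∀ i, ∀ᵐ y : ℝ, ∀ p : ℕ, MemLp (fun ω => (M.dens t i (X t ω) y : ℝ)) p P) :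
    ∀ᵐ ω ∂P, M.IsRegularData A T (fun t => Y t ω) := by
  have hZ : ∀ᵐ ω ∂P, ∀ t ≤ T, ∫⁻ x, M.lik A t (Y t ω) x ∂M.pred A t (fun s => Y s ω) ≠ 0 :=
    ae_all_iff.2 fun t => ae_all_iff.2 fun ht => h.ae_lintegral_lik_pred_ne_zero hA hatoms ht
  have hlik : ∀ᵐ ω ∂P, ∀ t ≤ T,
      AllMoments (fun x => (M.lik A t (Y t ω) x : ℝ)) (markovLaw M.init M.trans t) :=
    ae_all_iff.2 fun t => ae_all_iff.2 fun ht => ae_of_ae_map (h.measurable_Y t ht).aemeasurable <|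
      (h.map_obs_absolutelyContinuous hA (hatoms t ht) ht).ae_le <| ae_allMoments_lik hA fun i =>
        (hdens t ht i).mono fun y hy => h.allMoments_map_state ht
          ((M.measurable_dens t i).comp measurable_prodMk_right).coe_nnreal_real hy
  filter_upwards [hZ, hlik] with ω hωZ hωlik
  refine ⟨hωZ, hωlik, fun t ht i hi => ?_⟩
  rw [← h.map_state ht, ae_map_iff (h.measurable_X t ht).aemeasurable
    (measurableSet_eq_fun (M.measurable_mass t i _) measurable_const)]
  exact (hatoms t ht i).mono fun ω' hω' => hω' _ hi

end Represents

end MixedSSM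

end RegularData

section Consistency

lemma exists_ne_zero_of_sum_div_pos {S : Type*} {K : ℕ} {g : S → ℝ≥0} {x : Fin K → S}
    (h : 0 < (∑ k, (g (x k) : ℝ)) / K) : ∃ k, g (x k) ≠ 0 := by
  by_contra! hzero
  simp [hzero] at h

lemma sum_mul_lintegral_le_of_sum_mul_integral_le {ι F : Type*} [Fintype ι] [MeasurableSpace F]
    {w : ι → ℝ≥0} {μ : ι → Measure F} {φ : F → ℝ} (hint : ∀ k, Integrable (fun z => φ z ^ 4) (μ k))
    {R : ℝ≥0} (hR : ∑ k, w k * ∫ z, φ z ^ 4 ∂μ k ≤ R * ∑ k, (w k : ℝ)) :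
    ∑ k, w k * ∫⁻ z, ‖φ z‖ₑ ^ 4 ∂μ k ≤ R * ∑ k, (w k : ℝ≥0∞) := by
  have hnonneg (z : F) : 0 ≤ φ z ^ 4 := by positivity
  have hlint (k : ι) : ∫⁻ z, ‖φ z‖ₑ ^ 4 ∂μ k = ENNReal.ofReal (∫ z, φ z ^ 4 ∂μ k) := by
    rw [ofReal_integral_eq_lintegral_ofReal (hint k) (ae_of_all _ hnonneg)]
    simp_rw [← enorm_pow, Real.enorm_of_nonneg (hnonneg _)]
  have hterm (k : ι) : 0 ≤ w k * ∫ z, φ z ^ 4 ∂μ k :=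
    mul_nonneg (w k).coe_nonneg (integral_nonneg hnonneg)
  simp_rw [hlint]
  simpa [ENNReal.ofReal_sum_of_nonneg, hterm, ENNReal.ofReal_mul] using ENNReal.ofReal_le_ofReal hR

lemma exists_eventually_sum_mul_le {S : Type*} {g : S → ℝ≥0} {q : S → ℝ} {x : ∀ K, Fin K → S}
    {Z Q : ℝ} (hZ : 0 < Z)
    (hg : Tendsto (fun K : ℕ => (∑ k, (g (x K k) : ℝ)) / K) atTop (𝓝 Z))
    (hgq : Tendsto (fun K : ℕ => (∑ k, g (x K k) * q (x K k)) / K) atTop (𝓝 Q)) :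
    ∃ R : ℕ, ∀ᶠ K in atTop, ∑ k, g (x K k) * q (x K k) ≤ R * ∑ k, (g (x K k) : ℝ) := by
  obtain ⟨R, hR⟩ := exists_nat_gt (Q / Z)
  rw [div_lt_iff₀ hZ] at hR
  refine ⟨R, ?_⟩
  filter_upwards [hgq.eventually_lt (hg.const_mul (R : ℝ)) hR, eventually_gt_atTop 0] with K hlt hK
  rw [← mul_div_assoc, div_lt_div_iff_of_pos_right (Nat.cast_pos.2 hK)] at hlt
  exact hlt.le

namespace MixedSSM

variable {E : ℕ → Type*} [∀ t, MeasurableSpace (E t)] {m : ℕ → ℕ} {M : MixedSSM E m}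
  {A : ∀ t, Fin (m t) → Set ℝ} {T : ℕ} {y : ∀ t, Fin (m t) → ℝ}
  {Ω' : Type*} [MeasurableSpace Ω'] {ν : Measure Ω'} {t : ℕ}

lemma IsRegularData.ae_keptWeight_eq_lik [IsProbabilityMeasure ν]
    (hy : M.IsRegularData A T y) {K : ℕ} {ξ : ∀ t, Ω' → Fin K → E t}
    {α : ℕ → Ω' → Fin K → Fin K} (h : M.IsRun T y K ν ξ α) (ht : t ≤ T) :
    ∀ᵐ ω ∂ν, (∃ k, M.lik A t (y t) (ξ t ω k) ≠ 0) →
      ∀ k, M.keptWeight t (y t) (ξ t ω) k = M.lik A t (y t) (ξ t ω k) := by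
  have hmass : ∀ᵐ x ∂markovLaw M.init M.trans t, ∀ i, y t i ∉ A t i → M.mass t i x (y t i) = 0 :=
    ae_all_iff.2 fun i => ae_all_iff.2 fun hi => hy.ae_mass_eq_zero t ht i hi
  filter_upwards [h.ae_forall_particle ht hmass] with ω hω hpos
  exact M.keptWeight_eq_lik hω hpos

namespace IsRun

variable {ξ : ∀ K t : ℕ, Ω' → Fin K → E t} {α : ∀ K : ℕ, ℕ → Ω' → Fin K → Fin K}

lemma tendsto_initial_mean (h : ∀ K, M.IsRun T y K ν (ξ K) (α K)) {φ : E 0 → ℝ}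
    (hφm : Measurable φ) (hφ : MemLp φ (4 : ℕ) M.init) :
    ∀ᵐ ω ∂ν, Tendsto (fun K : ℕ => (∑ k, φ (ξ K 0 ω k)) / K) atTop
      (𝓝 (∫ x, φ x ∂M.init)) := by
  have hfin := (memLp_natCast_iff hφm four_ne_zero).1 hφ
  have herr := ae_tendsto_zero_of_measure_le_div_sq (ν := ν)
    (D := fun K ω => (∑ k, φ (ξ K 0 ω k)) / K - ∫ x, φ x ∂M.init) (G := fun _ _ => Set.univ)
    (fun _ ε hε => ⟨_, fun K hK => (measure_mono fun ω hω => hω.2).trans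
      ((h K).measure_init_error_ge_le hK hφm (ENNReal.coe_toNNReal hfin.ne).ge hε)⟩)
    (ae_of_all _ fun ω => ⟨0, .of_forall fun _ => trivial⟩)
  filter_upwards [herr] with ω hω
  exact tendsto_sub_nhds_zero_iff.1 hω

variable [IsProbabilityMeasure ν]

lemma ae_exists_eventually_moment_le (h : ∀ K, M.IsRun T y K ν (ξ K) (α K)) (ht : t < T)
    {g : E t → ℝ≥0} {φ : E (t + 1) → ℝ} (hφ : AllMoments φ (markovLaw M.init M.trans (t + 1)))
    {Z Q : ℝ} (hZ : 0 < Z)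
    (hg : ∀ᵐ ω ∂ν, Tendsto (fun K : ℕ => (∑ k, (g (ξ K t ω k) : ℝ)) / K) atTop (𝓝 Z))
    (hgq : ∀ᵐ ω ∂ν, Tendsto (fun K : ℕ =>
      (∑ k, g (ξ K t ω k) * ∫ z, φ z ^ 4 ∂M.trans t (ξ K t ω k)) / K) atTop (𝓝 Q)) :
    ∀ᵐ ω ∂ν, ∃ R : ℕ, ∀ᶠ K in atTop, (∃ k, g (ξ K t ω k) ≠ 0) ∧
      ∑ k, g (ξ K t ω k) * ∫⁻ z, ‖φ z‖ₑ ^ 4 ∂M.trans t (ξ K t ω k)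
        ≤ (R : ℝ≥0) * ∑ k, (g (ξ K t ω k) : ℝ≥0∞) := by
  have hint : ∀ᵐ x ∂markovLaw M.init M.trans t, Integrable (fun z => φ z ^ 4) (M.trans t x) :=
    Measure.ae_integrable_of_integrable_comp (hφ.pow 4).integrable
  filter_upwards [hg, hgq, ae_all_iff.2 fun K => (h K).ae_forall_particle ht.le hint]
    with ω hωg hωq hωint
  obtain ⟨R, hR⟩ := exists_eventually_sum_mul_le
    (q := fun x => ∫ z, φ z ^ 4 ∂M.trans t x) hZ hωg hωq
  refine ⟨R, ?_⟩
  filter_upwards [hωg.eventually_const_lt hZ, hR] with K hpos hle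
  exact ⟨exists_ne_zero_of_sum_div_pos hpos, sum_mul_lintegral_le_of_sum_mul_integral_le
    (hωint K) (by exact_mod_cast hle)⟩

lemma tendsto_succ_mean (h : ∀ K, M.IsRun T y K ν (ξ K) (α K)) (ht : t < T) {g : E t → ℝ≥0}
    (hg : Measurable g) (hw : ∀ K, ∀ᵐ ω ∂ν, (∃ k, g (ξ K t ω k) ≠ 0) →
      ∀ k, M.keptWeight t (y t) (ξ K t ω) k = g (ξ K t ω k))
    {φ : E (t + 1) → ℝ} (hφm : Measurable φ) (hφ : AllMoments φ (markovLaw M.init M.trans (t + 1)))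
    {η : Measure (E t)} (hZ : 0 < ∫ x, (g x : ℝ) ∂η)
    (hmean : ∀ ψ : E t → ℝ, Measurable ψ → AllMoments ψ (markovLaw M.init M.trans t) →
      ∀ᵐ ω ∂ν, Tendsto (fun K : ℕ => (∑ k, g (ξ K t ω k) * ψ (ξ K t ω k)) / K) atTop
        (𝓝 (∫ x, g x * ψ x ∂η))) :
    ∀ᵐ ω ∂ν, Tendsto (fun K : ℕ => (∑ k, φ (ξ K (t + 1) ω k)) / K) atTop
      (𝓝 ((∫ x, g x * ∫ z, φ z ∂M.trans t x ∂η) / ∫ x, (g x : ℝ) ∂η)) := by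
  have hlim := hmean _ (measurable_integral_kernel _ hφm) (AllMoments.integral_kernel hφm hφ)
  have hlim4 := hmean _ (measurable_integral_kernel _ (hφm.pow_const 4))
    (AllMoments.integral_kernel (hφm.pow_const 4) (hφ.pow 4))
  have hlim1 : ∀ᵐ ω ∂ν, Tendsto (fun K : ℕ => (∑ k, (g (ξ K t ω k) : ℝ)) / K) atTop
      (𝓝 (∫ x, (g x : ℝ) ∂η)) := by
    simpa using hmean (fun _ => 1) measurable_const fun _ => memLp_const 1
  have herr := ae_tendsto_zero_of_measure_le_div_sq
    (fun (R : ℕ) ε hε => ⟨_, fun K hK =>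
      (h K).measure_succ_error_ge_le hK ht hg (hw K) hφm (R : ℝ≥0) hε⟩)
    (ae_exists_eventually_moment_le h ht hφ hZ hlim1 hlim4)
  filter_upwards [herr, hlim1, hlim] with ω hω hω1 hωφ
  have hsum := hω.add (hωφ.div hω1 hZ.ne')
  rw [zero_add] at hsum
  refine hsum.congr' ?_
  filter_upwards [eventually_gt_atTop 0] with K hK
  rw [Pi.div_apply, div_div_div_cancel_right₀ (Nat.cast_ne_zero.2 hK.ne'), sub_add_cancel]

lemma tendsto_empirical_mean (h : ∀ K, M.IsRun T y K ν (ξ K) (α K))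
    (hA : ∀ t i, (A t i).Countable) (hy : M.IsRegularData A T y) (ht : t ≤ T) {φ : E t → ℝ}
    (hφm : Measurable φ) (hφ : AllMoments φ (markovLaw M.init M.trans t)) :
    ∀ᵐ ω ∂ν, Tendsto (fun K : ℕ => (∑ k, φ (ξ K t ω k)) / K) atTop
      (𝓝 (∫ x, φ x ∂M.pred A t y)) := by
  have hlik (t : ℕ) := M.measurable_lik_apply hA t (y t)
  induction t with
  | zero => exact tendsto_initial_mean h hφm (hφ 4)
  | succ t ih =>
    have ht' : t ≤ T := Nat.le_of_lt ht
    rw [pred, integral_predLaw_succ hlik hy.allMoments_lik hy.lintegral_lik_pred_ne_zero ht hφm hφ]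
    exact tendsto_succ_mean h ht (hlik t) (fun K => hy.ae_keptWeight_eq_lik (h K) ht') hφm hφ
      (integral_predLaw_pos hlik hy.allMoments_lik hy.lintegral_lik_pred_ne_zero ht')
      fun ψ hψm hψ => ih ht' ((hlik t).coe_nnreal_real.mul hψm)
        ((hy.allMoments_lik t ht').mul hψ)

lemma tendsto_output (h : ∀ K, M.IsRun T y K ν (ξ K) (α K))
    (hA : ∀ t i, (A t i).Countable) (hy : M.IsRegularData A T y) (ht : t ≤ T) {φ : E t → ℝ}
    (hφm : Measurable φ) (hφ : AllMoments φ (markovLaw M.init M.trans t)) :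
    ∀ᵐ ω ∂ν, Tendsto (fun K => M.output t (y t) φ (ξ K t ω)) atTop
      (𝓝 (∫ x, φ x ∂M.filt A t y)) := by
  have hlik (t : ℕ) := M.measurable_lik_apply hA t (y t)
  have hZ : 0 < ∫ x, (M.lik A t (y t) x : ℝ) ∂M.pred A t y :=
    integral_predLaw_pos hlik hy.allMoments_lik hy.lintegral_lik_pred_ne_zero ht
  have hden := tendsto_empirical_mean h hA hy ht (hlik t).coe_nnreal_real (hy.allMoments_lik t ht)
  have hnum := tendsto_empirical_mean h hA hy ht ((hlik t).coe_nnreal_real.mul hφm)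
    ((hy.allMoments_lik t ht).mul hφ)
  rw [filt, integral_bayesUpdate (hlik t) (hy.lintegral_lik_pred_ne_zero t ht)]
  filter_upwards [hden, hnum, ae_all_iff.2 fun K => hy.ae_keptWeight_eq_lik (h K) ht]
    with ω hωden hωnum hkept
  refine (hωnum.div hωden hZ.ne').congr' ?_
  filter_upwards [hωden.eventually_const_lt hZ, eventually_gt_atTop 0] with K hpos hK
  simp only [Pi.div_apply, Pi.mul_apply, output, hkept K (exists_ne_zero_of_sum_div_pos hpos)]
  rw [div_div_div_cancel_right₀ (Nat.cast_ne_zero.2 hK.ne')]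

end IsRun

end MixedSSM

end Consistency

end LPF

end

theorem theorem4 {E : ℕ → Type*} [∀ t, MeasurableSpace (E t)] {m : ℕ → ℕ}
    (M : LPF.MixedSSM E m) (T : ℕ)
    {Ω : Type*} [MeasurableSpace Ω] (P : Measure Ω) [IsProbabilityMeasure P]
    (X : ∀ t, Ω → E t) (Y : ∀ t, Ω → Fin (m t) → ℝ) (hXY : M.Represents T P X Y)
    (hatoms : ∀ t ≤ T, ∀ i, ∃ A : Set ℝ, A.Countable ∧
      ∀ᵐ ω ∂P, ∀ y, y ∉ A → M.mass t i (X t ω) y = 0)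
    (hdens : ∀ t ≤ T, ∀ i, ∀ᵐ y : ℝ ∂volume, ∀ p : ℕ,
      MemLp (fun ω => (M.dens t i (X t ω) y : ℝ)) p P)
    (f : ∀ t, E t → ℝ) (hf : ∀ t ≤ T, Measurable (f t))
    (hfX : ∀ t ≤ T, ∀ p : ℕ, MemLp (fun ω => f t (X t ω)) p P) :
    ∀ᵐ ω ∂P, ∀ (Ω' : Type*) [MeasurableSpace Ω'] (ν : Measure Ω') [IsProbabilityMeasure ν]
      (ξ : ∀ K t : ℕ, Ω' → Fin K → E t) (α : ∀ K : ℕ, ℕ → Ω' → Fin K → Fin K),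
      (∀ K, M.IsRun T (fun t => Y t ω) K ν (ξ K) (α K)) →
      ∀ᵐ ω' ∂ν, ∀ t ≤ T,
        Tendsto (fun K => M.output t (Y t ω) (f t) (ξ K t ω')) atTop
          (𝓝 ((P[fun ω => f t (X t ω) | LPF.obsSigma Y t]) ω)) := by
  have hcand (t : ℕ) (i : Fin (m t)) : ∃ A : Set ℝ, A.Countable ∧
      (t ≤ T → ∀ᵐ ω ∂P, ∀ y, y ∉ A → M.mass t i (X t ω) y = 0) := by
    by_cases ht : t ≤ T
    · exact (hatoms t ht i).imp fun A h => ⟨h.1, fun _ => h.2⟩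
    · exact ⟨∅, Set.countable_empty, fun h => absurd h ht⟩
  choose A hA hmass using hcand
  have hA_atoms : ∀ t ≤ T, ∀ i, ∀ᵐ ω ∂P, ∀ y, y ∉ A t i → M.mass t i (X t ω) y = 0 :=
    fun t ht i => hmass t i ht
  have hcond : ∀ᵐ ω ∂P, ∀ t ≤ T,
      P[fun ω => f t (X t ω) | LPF.obsSigma Y t] ω = ∫ x, f t x ∂M.filt A t (fun s => Y s ω) :=
    ae_all_iff.2 fun t => ae_all_iff.2 fun ht => hXY.condExp_ae_eq_integral_filt hA hA_atoms ht
      (hf t ht) ((hfX t ht 1).integrable (by norm_num))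
  filter_upwards [hXY.ae_isRegularData hA hA_atoms hdens, hcond]
    with ω hreg hfilt Ω' _ ν _ ξ α hrun
  refine ae_all_iff.2 fun t => ae_all_iff.2 fun ht => ?_
  rw [hfilt t ht]
  exact LPF.MixedSSM.IsRun.tendsto_output hrun hA hreg ht (hf t ht)
    (hXY.allMoments_map_state ht (hf t ht) (hfX t ht))
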